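/- Let $n\ge 1$, let $e_1,\dots,e_n$ be the standard basis of $\mathbb R^n$, and consider the classical root systems with positive roots $A_{n-1}^+=\{e_i-e_j : i<j\}$, $B_n^+=\{e_i\pm e_j : i<j\}\cup\{e_i\}$, $C_n^+=\{e_i\pm e_j : i<j\}\cup\{2e_i\}$, $D_n^+=\{e_i\pm e_j : i<j\}$, where $1\le i,j\le n$. For $\Phi\in\{A_{n-1},B_n,C_n,D_n\}$ the standard and the integral Coxeter permutahedron are the Minkowski sums $$\Pi(\Phi)=\sum_{\alpha\in\Phi^+}\left[-\tfrac{\alpha}{2},\tfrac{\alpha}{2}\right],\qquad \Pi^{\mathbb Z}(\Phi)=\sum_{\alpha\in\Phi^+}[0,\alpha]$$ in $\mathbb R^n$. For a polytope $P\subset\mathbb R^n$ and a positive integer $t$ let $\mathrm{ehr}_P(t)=|tP\cap\mathbb Z^n|$. Consider signed graphs on $[n]=\{1,\dots,n\}$ in which any two distinct vertices may be joined by a positive edge, a negative edge, or both, and every vertex may carry at most one halfedge and at most one negative loop. A $\Phi$-graph is such a graph with only positive edges, no halfedges and no loops if $\Phi=A_{n-1}$; without loops if $\Phi=B_n$; without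 halfedges if $\Phi=C_n$; without halfedges and loops if $\Phi=D_n$. Two parallel edges of opposite signs form a cycle (of length 2); loops and halfedges are not counted as cycles. A cycle is unbalanced if it has an odd number of negative edges. A connected signed graph is a tree if it has no cycles, loops or halfedges; a halfedge-tree if it has no cycles or loops and exactly one halfedge; a loop-tree if it has no cycles or halfedges and exactly one loop; a pseudotree if it has no loops or halfedges and contains exactly one cycle, which is unbalanced. A $\Phi$-forest is a $\Phi$-graph each of whose connected components is a tree, a halfedge-tree, a loop-tree or a pseudotree; $\mathrm{tc}(G)$, $\mathrm{lc}(G)$, $\mathrm{pc}(G)$ denote the numbers of components of $G$ that are trees, loop-trees, pseudotrees. Let $\mathcal F(\Phi)$ be the set of $\Phi$-forests on $[n]$, and $\mathcal E(\Phi)\subseteq\mathcal F(\Phi)$ the set of those in which every tree component has an even number of vertices. **Theorem 4.3.** 1. For every $\Phi\in\{A_{n-1},B_n,C_n,D_n\}$, the Ehrhart polynomial of the integral Coxeter permutahedron is $$\mathrm{ehr}_{\Pi^{\mathbb Z}(\Phi)}(t)=\sum_{G\in\mathcal F(\Phi)}2^{\mathrm{pc}(G)+\mathrm{lc}(G)}\,t^{\,n-\mathrm{tc}(G)}.$$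 2. For $\Phi=A_{n-1}$ with $n\geq 2$ even, and for $\Phi=B_n$ with $n\ge 1$, the Ehrhart quasipolynomial of the standard Coxeter permutahedron has (minimal) period $2$ and is $$\mathrm{ehr}_{\Pi(\Phi)}(t)=\begin{cases}\displaystyle\sum_{G\in\mathcal F(\Phi)}2^{\mathrm{pc}(G)}\,t^{\,n-\mathrm{tc}(G)}&\text{if } t \text{ is even},\\[2ex]\displaystyle\sum_{G\in\mathcal E(\Phi)}2^{\mathrm{pc}(G)}\,t^{\,n-\mathrm{tc}(G)}&\text{if } t \text{ is odd}.\end{cases}$$ For $\Phi=A_{n-1}$ with $n\ge 1$ odd, and for $\Phi=C_n$ or $\Phi=D_n$ with $n\ge 1$, one has $\mathrm{ehr}_{\Pi(\Phi)}(t)=\mathrm{ehr}_{\Pi^{\mathbb Z}(\Phi)}(t)$ for every positive integer $t$. -/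

import Mathlib

open scoped Pointwise

noncomputable section

/-! ### Ehrhart theory in `ℝⁿ` with respect to the lattice `ℤⁿ` -/

/-- The lattice point count `|tP ∩ ℤⁿ|`, as an extended natural number. -/
def ehr {n : ℕ} (P : Set (Fin n → ℝ)) (t : ℕ) : ℕ∞ :=
  {x : Fin n → ℝ | x ∈ (t : ℝ) • P ∧ ∀ i, ∃ z : ℤ, x i = (z : ℝ)}.encard

/-- `f` is the Ehrhart polynomial of `P`: for every positive integer `t` the set `tP ∩ ℤⁿ`
is finite and has exactly `f(t)` elements. -/
def IsEhrhartPolynomial {n : ℕ} (P : Set (Fin n → ℝ)) (f : Polynomial ℚ) : Prop :=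
  ∀ t : ℕ, 0 < t → ∃ m : ℕ, ehr P t = (m : ℕ∞) ∧ (m : ℚ) = f.eval (t : ℚ)

/-- The quasipolynomial `t ↦ ∑ i, cᵢ(t) tⁱ`, recorded by the polynomials
`q t = ∑ i, cᵢ(t) Xⁱ`, is the Ehrhart quasipolynomial of `P`, and it has period `p`, meaning
that `p` is the minimal common period of its coefficient functions `cᵢ : ℤ → ℚ`. -/
structure IsEhrhartQuasipolynomial {n : ℕ} (P : Set (Fin n → ℝ)) (p : ℕ)
    (q : ℤ → Polynomial ℚ) : Prop where
  period : IsLeast {r : ℕ | 0 < r ∧ Function.Periodic q (r : ℤ)} p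
  count : ∀ t : ℕ, 0 < t → ∃ m : ℕ, ehr P t = (m : ℕ∞) ∧ (m : ℚ) = (q (t : ℤ)).eval (t : ℚ)

/-! ### Classical root systems and their Coxeter permutahedra -/

/-- The four classical types. In dimension `n` they stand for the root systems
`A_{n-1}`, `B_n`, `C_n`, `D_n`, all of them living in `ℝⁿ`. -/
inductive ClassicalType where
  | A
  | B
  | C
  | D

/-- The standard basis vector `e_i` of `ℝⁿ`. -/
def stdVec {n : ℕ} (i : Fin n) : Fin n → ℝ := Pi.single i 1

/-- The vectors `e_i - e_j` with `i < j`. -/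
def rootsMinus (n : ℕ) : Finset (Fin n → ℝ) :=
  (Finset.univ.filter fun p : Fin n × Fin n => p.1 < p.2).image
    fun p => stdVec p.1 - stdVec p.2

/-- The vectors `e_i + e_j` with `i < j`. -/
def rootsPlus (n : ℕ) : Finset (Fin n → ℝ) :=
  (Finset.univ.filter fun p : Fin n × Fin n => p.1 < p.2).image
    fun p => stdVec p.1 + stdVec p.2

/-- The vectors `e_i`. -/
def rootsShort (n : ℕ) : Finset (Fin n → ℝ) :=
  Finset.univ.image fun i : Fin n => stdVec i

/-- The vectors `2 e_i`. -/
def rootsLong (n : ℕ) : Finset (Fin n → ℝ) :=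
  Finset.univ.image fun i : Fin n => (2 : ℝ) • stdVec i

/-- The positive roots of `A_{n-1}`, `B_n`, `C_n`, `D_n`. -/
def posRoots (n : ℕ) : ClassicalType → Finset (Fin n → ℝ)
  | .A => rootsMinus n
  | .B => rootsMinus n ∪ rootsPlus n ∪ rootsShort n
  | .C => rootsMinus n ∪ rootsPlus n ∪ rootsLong n
  | .D => rootsMinus n ∪ rootsPlus n

/-- The standard Coxeter permutahedron, the Minkowski sum of the segments `[-α/2, α/2]`
over the positive roots `α`. -/
def standardPermutahedron (Φ : ClassicalType) (n : ℕ) : Set (Fin n → ℝ) :=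
  ∑ α ∈ posRoots n Φ, segment ℝ (-((1 / 2 : ℝ) • α)) ((1 / 2 : ℝ) • α)

/-- The integral Coxeter permutahedron, the Minkowski sum of the segments `[0, α]`
over the positive roots `α`. -/
def integralPermutahedron (Φ : ClassicalType) (n : ℕ) : Set (Fin n → ℝ) :=
  ∑ α ∈ posRoots n Φ, segment ℝ 0 α

/-! ### Signed graphs -/

/-- A signed graph on the vertex set `V` without loose edges, without repeated signed edges and
without positive loops. Each pair of distinct vertices may be joined by a positive edge, by a
negative edge, or by both. -/
@[ext]
structure SignedGraph (V : Type*) where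
  /-- the positive edges -/
  pos : SimpleGraph V
  /-- the negative edges -/
  neg : SimpleGraph V
  /-- the vertices carrying a halfedge -/
  half : Set V
  /-- the vertices carrying a (negative) loop -/
  loop : Set V

namespace SignedGraph

variable {V : Type*}

instance [Finite V] : Finite (SignedGraph V) :=
  Finite.of_injective (fun G : SignedGraph V => (G.pos, G.neg, G.half, G.loop)) (by
    intro G H h
    simp only [Prod.mk.injEq] at h
    exact SignedGraph.ext h.1 h.2.1 h.2.2.1 h.2.2.2)

instance [Finite V] : Fintype (SignedGraph V) := Fintype.ofFinite _

/-- The simple graph recording which distinct vertices are joined by some edge. -/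
def underlying (G : SignedGraph V) : SimpleGraph V := G.pos ⊔ G.neg

/-- The signed graph is connected (in particular it has a vertex). -/
def Connected (G : SignedGraph V) : Prop := G.underlying.Connected

/-- The set of edges joining distinct vertices, each with its sign `1` or `-1`. -/
def edges (G : SignedGraph V) : Set (Sym2 V × ℤˣ) :=
  {e | (e.1 ∈ G.pos.edgeSet ∧ e.2 = 1) ∨ (e.1 ∈ G.neg.edgeSet ∧ e.2 = -1)}

/-- `C` is the edge set of a cycle of `G`, running through `m ≥ 2` distinct vertices `v 0, v 1, …`
in cyclic order and using distinct signed edges. For `m = 2` the cycle consists of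
two parallel edges of opposite signs. -/
def IsCycle (G : SignedGraph V) (C : Set (Sym2 V × ℤˣ)) : Prop :=
  ∃ (m : ℕ) (v : ZMod m → V) (s : ZMod m → ℤˣ), 2 ≤ m ∧ Function.Injective v ∧
    Function.Injective (fun i => (s(v i, v (i + 1)), s i)) ∧
    (∀ i, (s(v i, v (i + 1)), s i) ∈ G.edges) ∧
    C = Set.range fun i => (s(v i, v (i + 1)), s i)

/-- The cycle with edge set `C` has an even number of negative edges. -/
def IsBalancedCycle (C : Set (Sym2 V × ℤˣ)) : Prop := Even {e ∈ C | e.2 = -1}.ncard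

/-- Signed trees. -/
def IsTree (G : SignedGraph V) : Prop :=
  G.Connected ∧ (∀ C, ¬ G.IsCycle C) ∧ G.half = ∅ ∧ G.loop = ∅

/-- Signed halfedge-trees. -/
def IsHalfedgeTree (G : SignedGraph V) : Prop :=
  G.Connected ∧ (∀ C, ¬ G.IsCycle C) ∧ (∃! v, v ∈ G.half) ∧ G.loop = ∅

/-- Signed loop-trees. -/
def IsLoopTree (G : SignedGraph V) : Prop :=
  G.Connected ∧ (∀ C, ¬ G.IsCycle C) ∧ G.half = ∅ ∧ ∃! v, v ∈ G.loop

/-- Signed pseudotrees: connected, no halfedges, no loops, and a single cycle, which is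
unbalanced. -/
def IsPseudotree (G : SignedGraph V) : Prop :=
  G.Connected ∧ (∃ C, G.IsCycle C ∧ ¬ IsBalancedCycle C ∧ ∀ C', G.IsCycle C' → C' = C) ∧
    G.half = ∅ ∧ G.loop = ∅

/-- The signed graph induced on a set of vertices. -/
def induce (G : SignedGraph V) (S : Set V) : SignedGraph S where
  pos := G.pos.induce S
  neg := G.neg.induce S
  half := {v | (v : V) ∈ G.half}
  loop := {v | (v : V) ∈ G.loop}

/-- A connected component of `G`, as a signed graph on its own vertex set. -/
def component (G : SignedGraph V) (c : G.underlying.ConnectedComponent) : SignedGraph c.supp :=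
  G.induce c.supp

/-- Signed pseudoforests. -/
def IsPseudoforest (G : SignedGraph V) : Prop :=
  ∀ c, (G.component c).IsTree ∨ (G.component c).IsHalfedgeTree ∨
    (G.component c).IsLoopTree ∨ (G.component c).IsPseudotree

/-- The number of tree components. -/
def tc (G : SignedGraph V) : ℕ := {c | (G.component c).IsTree}.ncard

/-- The number of loop-tree components. -/
def lc (G : SignedGraph V) : ℕ := {c | (G.component c).IsLoopTree}.ncard

/-- The number of pseudotree components. -/
def pc (G : SignedGraph V) : ℕ := {c | (G.component c).IsPseudotree}.ncard

/-- The `Φ`-graphs, which encode the subsets of the positive roots: a positive edge `ij` stands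
for `±(e_i - e_j)`, a negative edge `ij` for `e_i + e_j`, a halfedge at `j` for `e_j` and a
loop at `j` for `2 e_j`. -/
def IsGraphOfType (G : SignedGraph V) : ClassicalType → Prop
  | .A => G.neg = ⊥ ∧ G.half = ∅ ∧ G.loop = ∅
  | .B => G.loop = ∅
  | .C => G.half = ∅
  | .D => G.half = ∅ ∧ G.loop = ∅

end SignedGraph

open Classical in
/-- The set of `Φ`-forests on `n` vertices. -/
def forests (Φ : ClassicalType) (n : ℕ) : Finset (SignedGraph (Fin n)) :=
  Finset.univ.filter fun G => G.IsGraphOfType Φ ∧ G.IsPseudoforest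

open Classical in
/-- The set of `Φ`-forests on `n` vertices all of whose tree components have an even number of
vertices. -/
def evenForests (Φ : ClassicalType) (n : ℕ) : Finset (SignedGraph (Fin n)) :=
  (forests Φ n).filter fun G => ∀ c, (G.component c).IsTree → Even c.supp.ncard

/-- The number of tree components never exceeds the number of vertices, so the exponent
`n - tc(G)` is an honest difference. -/
theorem SignedGraph.tc_le {n : ℕ} (G : SignedGraph (Fin n)) : G.tc ≤ n := by
  have h1 : G.tc ≤ Nat.card G.underlying.ConnectedComponent := by
    rw [← Set.ncard_univ]
    exact Set.ncard_le_ncard (Set.subset_univ _) (Set.toFinite _)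
  have h2 : Nat.card G.underlying.ConnectedComponent ≤ Nat.card (Fin n) :=
    Nat.card_le_card_of_surjective G.underlying.connectedComponentMk
      (fun c => c.exists_rep)
  simpa using h1.trans h2

end

/-!
The lattice points of a translated zonotope `w + ∑ [0, uᵢ]` are counted by removing one generator at
a time: what a segment adds to a convex set is counted by contracting the segment, that is, modulo
its generator. This leaves one term for every linearly independent set `S` of generators, namely the
number of residue classes modulo `ℤS` of lattice points in the affine space `w + span S`. If that
space contains a lattice point at all, this number is the index of `ℤS` in `ℤⁿ ∩ span S`.

Sets of positive roots are signed graphs. The roots of a signed graph with `b` balanced components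
span a space of dimension `n - b`, so the independent sets are the pseudoforests, whose balanced
components are the trees; each loop-tree and each pseudotree contributes a factor `2` to the index.

The standard permutahedron is the integral one, translated by half the sum of the positive roots.
For a translation vector `w` with coordinates in `ℤ + 1/2`, the space `w + span S` meets `ℤⁿ`
exactly if every tree has an even number of vertices: on a tree, `span S` is cut out by one equation
with coefficients `±1`.
-/

/-! ### Lattice points of zonotopes by deletion and contraction -/

section Residues

variable {Λ : Type*} [AddCommGroup Λ] {L : AddSubgroup Λ} {S T : Set Λ}

/-- The number of residue classes modulo `L` that meet `S`. In the deletion-contraction recursion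
for lattice points, contracting a generator enlarges the lattice `L`. -/
noncomputable def residueCount (L : AddSubgroup Λ) (S : Set Λ) : ℕ∞ :=
  ((↑) '' S : Set (Λ ⧸ L)).encard

theorem residueCount_empty : residueCount L ∅ = 0 := by
  rw [residueCount, Set.image_empty, Set.encard_empty]

theorem residueCount_bot : residueCount ⊥ S = S.encard := by
  refine Set.InjOn.encard_image fun x _ y _ hxy => ?_
  rwa [QuotientAddGroup.eq, AddSubgroup.mem_bot, neg_add_eq_zero] at hxy

theorem mk_mem_image_mk_iff (hS : ∀ l ∈ L, ∀ x ∈ S, x + l ∈ S) {x : Λ} :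
    (x : Λ ⧸ L) ∈ ((↑) '' S : Set (Λ ⧸ L)) ↔ x ∈ S := by
  constructor
  · rintro ⟨y, hy, hyx⟩
    simpa using hS _ (QuotientAddGroup.eq.mp hyx) _ hy
  · exact Set.mem_image_of_mem _

theorem residueCount_eq_add_sdiff (hST : S ⊆ T) (hS : ∀ l ∈ L, ∀ x ∈ S, x + l ∈ S) :
    residueCount L T = residueCount L S + residueCount L (T \ S) := by
  rw [residueCount, ← Set.union_sdiff_cancel hST, Set.image_union, Set.union_sdiff_cancel hST]
  refine Set.encard_union_eq (Set.disjoint_right.mpr ?_)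
  rintro _ ⟨x, ⟨-, hx⟩, rfl⟩
  exact fun hxS => hx ((mk_mem_image_mk_iff hS).mp hxS)

theorem residueCount_sup_zmultiples {u : Λ} (hS : ∀ l ∈ L, ∀ x ∈ S, x + l ∈ S) (hST : S ⊆ T)
    (hT : ∀ x ∈ T, ∃! k : ℤ, x + k • u ∈ S) :
    residueCount (L ⊔ AddSubgroup.zmultiples u) T = residueCount L S := by
  let π : Λ ⧸ L →+ Λ ⧸ (L ⊔ AddSubgroup.zmultiples u) :=
    QuotientAddGroup.map _ _ (AddMonoidHom.id Λ) le_sup_left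
  have hπ (x : Λ) : π x = (x : Λ ⧸ (L ⊔ AddSubgroup.zmultiples u)) := rfl
  have himage : ((↑) '' T : Set (Λ ⧸ (L ⊔ AddSubgroup.zmultiples u))) = π '' ((↑) '' S) := by
    apply Set.Subset.antisymm
    · rintro _ ⟨x, hx, rfl⟩
      obtain ⟨k, hk, -⟩ := hT x hx
      refine ⟨_, ⟨x + k • u, hk, rfl⟩, ?_⟩
      rw [hπ, eq_comm, QuotientAddGroup.eq, neg_add_cancel_left]
      exact AddSubgroup.mem_sup_right (AddSubgroup.zsmul_mem_zmultiples u k)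
    · rintro _ ⟨_, ⟨x, hx, rfl⟩, rfl⟩
      exact ⟨x, hST hx, rfl⟩
  have hinj : Set.InjOn π ((↑) '' S) := by
    rintro _ ⟨x, hx, rfl⟩ _ ⟨y, hy, rfl⟩ hxy
    rw [hπ, hπ, QuotientAddGroup.eq, AddSubgroup.mem_sup] at hxy
    obtain ⟨l, hl, _, ⟨k, rfl⟩, hlk : l + k • u = -x + y⟩ := hxy
    have hxk : x + k • u ∈ S := by
      have hy' : y + -l = x + k • u := by
        rw [eq_neg_add_iff_add_eq] at hlk
        rw [← hlk]
        abel
      exact hy' ▸ hS _ (L.neg_mem hl) y hy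
    have hk : k = 0 := (hT x (hST hx)).unique hxk (by simpa using hx)
    rw [QuotientAddGroup.eq, ← hlk]
    simpa [hk] using hl
  rw [residueCount, himage, hinj.encard_image, residueCount]

theorem residueCount_setOf_sub_mem {L : AddSubgroup Λ} (A : AddSubgroup Λ) (x : Λ)
    (hL : L.relIndex A ≠ 0) : residueCount L {y | y - x ∈ A} = L.relIndex A := by
  have himage : ((↑) '' {y | y - x ∈ A} : Set (Λ ⧸ L)) =
      ((x : Λ ⧸ L) + ·) '' (A.map (QuotientAddGroup.mk' L) : Set (Λ ⧸ L)) := by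
    apply Set.Subset.antisymm
    · rintro _ ⟨y, hy, rfl⟩
      exact ⟨_, ⟨y - x, hy, rfl⟩, by simp⟩
    · rintro _ ⟨_, ⟨y, hy, rfl⟩, rfl⟩
      exact ⟨x + y, by simpa using hy, rfl⟩
  have hcard : L.relIndex A = (A.map (QuotientAddGroup.mk' L) : Set (Λ ⧸ L)).ncard := by
    conv_lhs => rw [← QuotientAddGroup.ker_mk' L, AddSubgroup.relIndex_ker]
    rfl
  rw [residueCount, himage, (add_right_injective _).encard_image, hcard,
    (Set.finite_of_ncard_ne_zero (hcard ▸ hL)).cast_ncard_eq]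

theorem map_mem_span_of_mem_closure {ι R V : Type*} [Ring R] [AddCommGroup V] [Module R V]
    {c : Λ →+ V} {u : ι → Λ} {I : Set ι} {l : Λ} (hl : l ∈ AddSubgroup.closure (u '' I)) :
    c l ∈ Submodule.span R ((c ∘ u) '' I) := by
  have hle : AddSubgroup.closure (u '' I) ≤
      (Submodule.span R ((c ∘ u) '' I)).toAddSubgroup.comap c := by
    rw [AddSubgroup.closure_le]
    rintro _ ⟨i, hi, rfl⟩
    exact Submodule.subset_span ⟨i, hi, rfl⟩
  exact hle hl

end Residues

section Line

variable {V : Type*} [AddCommGroup V] [Module ℝ V] {P : Set V} {v : V}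

theorem mem_add_segment_zero_iff {x : V} :
    x ∈ P + segment ℝ 0 v ↔ ∃ s ∈ Set.Icc (0 : ℝ) 1, x - s • v ∈ P := by
  simp only [segment_eq_image, smul_zero, zero_add, Set.mem_add, Set.exists_mem_image]
  constructor
  · rintro ⟨p, hp, s, hs, rfl⟩
    exact ⟨s, hs, by rwa [add_sub_cancel_right]⟩
  · rintro ⟨s, hs, hx⟩
    exact ⟨_, hx, s, hs, sub_add_cancel x _⟩

theorem mem_add_span_singleton_iff {x : V} :
    x ∈ P + (Submodule.span ℝ {v} : Set V) ↔ ∃ r : ℝ, x + r • v ∈ P := by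
  constructor
  · rintro ⟨p, hp, _, hq, rfl⟩
    obtain ⟨r, rfl⟩ := Submodule.mem_span_singleton.mp hq
    exact ⟨-r, by simpa using hp⟩
  · rintro ⟨r, hr⟩
    exact ⟨_, hr, (-r) • v, Submodule.smul_mem _ _ (Submodule.mem_span_singleton_self v), by simp⟩

theorem exists_forall_mem_add_segment_sdiff_iff {a : V} (hconv : Convex ℝ P)
    (hcompact : IsCompact {r : ℝ | a + r • v ∈ P}) (hne : {r : ℝ | a + r • v ∈ P}.Nonempty) :
    ∃ b : ℝ, ∀ r : ℝ, a + r • v ∈ (P + segment ℝ 0 v) \ P ↔ r ∈ Set.Ioc b (b + 1) := by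
  set I := {r : ℝ | a + r • v ∈ P} with hI
  have hmax : sSup I ∈ I := hcompact.sSup_mem hne
  have hord : I.OrdConnected := by
    refine Convex.ordConnected ?_
    simpa [AffineMap.lineMap_apply, Set.preimage, add_comm] using
      hconv.affine_preimage (AffineMap.lineMap a (a + v))
  have hseg (r : ℝ) : a + r • v ∈ P + segment ℝ 0 v ↔ ∃ s ∈ Set.Icc (0 : ℝ) 1, r - s ∈ I := by
    simp only [mem_add_segment_zero_iff, hI, Set.mem_ofPred_eq, sub_smul, add_sub_assoc]
  refine ⟨sSup I, fun r => ?_⟩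
  rw [Set.mem_sdiff, hseg]
  constructor
  · rintro ⟨⟨s, ⟨h0, h1⟩, hs⟩, hr⟩
    have hle := le_csSup hcompact.bddAbove hs
    refine ⟨?_, by linarith⟩
    by_contra! hlt
    exact hr (hord.out hs hmax ⟨by linarith, hlt⟩)
  · rintro ⟨h1, h2⟩
    refine ⟨⟨r - sSup I, ⟨by linarith, by linarith⟩, ?_⟩,
      fun hr => h1.not_ge (le_csSup hcompact.bddAbove hr)⟩
    rwa [sub_sub_cancel]

theorem existsUnique_int_smul_mem_add_segment_sdiff {a : V} (hconv : Convex ℝ P)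
    (hcompact : IsCompact {r : ℝ | a + r • v ∈ P}) (hne : {r : ℝ | a + r • v ∈ P}.Nonempty) :
    ∃! k : ℤ, a + (k : ℝ) • v ∈ (P + segment ℝ 0 v) \ P := by
  obtain ⟨b, hb⟩ := exists_forall_mem_add_segment_sdiff_iff hconv hcompact hne
  simpa only [hb, zero_add, zsmul_one] using existsUnique_add_zsmul_mem_Ioc one_pos (0 : ℝ) b

theorem segment_zero_add_submodule {W : Submodule ℝ V} (hv : v ∈ W) :
    segment ℝ 0 v + (W : Set V) = W := by
  apply Set.Subset.antisymm
  · rintro _ ⟨p, hp, q, hq, rfl⟩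
    exact W.add_mem (W.convex.segment_subset W.zero_mem hv hp) hq
  · exact fun x hx => ⟨0, left_mem_segment ℝ _ _, x, hx, zero_add x⟩

theorem mem_singleton_add_submodule_iff {W : Submodule ℝ V} {w x : V} :
    x ∈ {w} + (W : Set V) ↔ x - w ∈ W := by
  simp [Set.singleton_add, neg_add_eq_sub]

theorem residueCount_preimage_singleton_add {Λ : Type*} [AddCommGroup Λ] {c : Λ →+ V}
    {L : AddSubgroup Λ} {W : Submodule ℝ V} {w : V} {x : Λ} (hx : c x - w ∈ W)
    (hL : L.relIndex (W.toAddSubgroup.comap c) ≠ 0) :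
    residueCount L (c ⁻¹' ({w} + (W : Set V))) = L.relIndex (W.toAddSubgroup.comap c) := by
  rw [← residueCount_setOf_sub_mem _ x hL]
  congr 1
  ext y
  rw [Set.mem_preimage, mem_singleton_add_submodule_iff, Set.mem_ofPred_eq, AddSubgroup.mem_comap,
    map_sub, ← sub_sub_sub_cancel_right (c y) (c x) w]
  exact (W.sub_mem_iff_left hx).symm

end Line

section Zonotope

variable {Λ V ι : Type*} [AddCommGroup Λ] [NormedAddCommGroup V] [NormedSpace ℝ V]

theorem isCompact_sum_segment (v : ι → V) (R : Finset ι) :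
    IsCompact (∑ i ∈ R, segment ℝ 0 (v i)) := by
  refine Finset.sum_induction _ IsCompact (fun _ _ => IsCompact.add) isCompact_singleton
    fun i _ => ?_
  rw [segment_eq_image]
  exact isCompact_Icc.image (by fun_prop)

variable [FiniteDimensional ℝ V] {W : Submodule ℝ V}

theorem isCompact_setOf_add_smul_mem_add_submodule {K : Set V} (hK : IsCompact K) {a v : V}
    (hv : v ∉ W) : IsCompact {r : ℝ | a + r • v ∈ K + (W : Set V)} := by
  have hclosed : IsClosed (K + (W : Set V)) :=
    (Submodule.closed_of_finiteDimensional W).add_left_of_isCompact hK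
  obtain ⟨f, hfv, hfW⟩ := Submodule.exists_le_ker_of_notMem hv
  have hf : Continuous f := f.continuous_of_finiteDimensional
  have himage : IsCompact ((fun k => (f k - f a) / f v) '' K) := hK.image (by fun_prop)
  refine himage.of_isClosed_subset (hclosed.preimage (by fun_prop)) ?_
  rintro r ⟨k, hk, w, hw, hkw⟩
  refine ⟨k, hk, (div_eq_iff hfv).mpr ?_⟩
  have hfw : f w = 0 := hfW hw
  simpa [hfw, sub_eq_iff_eq_add, add_comm] using congrArg f hkw

theorem residueCount_preimage_add_segment {K : Set V} (hK : IsCompact K) (hconv : Convex ℝ K)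
    {c : Λ →+ V} {L : AddSubgroup Λ} (hL : ∀ l ∈ L, c l ∈ W) {u : Λ} (hu : c u ∉ W) :
    residueCount L (c ⁻¹' (K + segment ℝ 0 (c u) + (W : Set V))) =
      residueCount L (c ⁻¹' (K + (W : Set V))) +
      residueCount (L ⊔ AddSubgroup.zmultiples u)
        (c ⁻¹' (K + ((W ⊔ Submodule.span ℝ {c u} : Submodule ℝ V) : Set V))) := by
  have hperiodic (M : Set V) :
      ∀ l ∈ L, ∀ x ∈ c ⁻¹' (M + (W : Set V)), x + l ∈ c ⁻¹' (M + (W : Set V)) := by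
    rintro l hl x ⟨k, hk, w, hw, hkw⟩
    refine ⟨k, hk, w + c l, W.add_mem hw (hL l hl), ?_⟩
    rw [map_add, ← hkw, add_assoc]
  have hsub : K + (W : Set V) ⊆ K + segment ℝ 0 (c u) + (W : Set V) :=
    Set.add_subset_add_right fun k hk => ⟨k, hk, 0, left_mem_segment ℝ _ _, add_zero k⟩
  rw [residueCount_eq_add_sdiff (Set.preimage_mono hsub) (hperiodic K)]
  congr 1
  refine (residueCount_sup_zmultiples ?_ ?_ fun x hx => ?_).symm
  · rintro l hl x ⟨hx, hx'⟩
    refine ⟨hperiodic _ l hl x hx, fun h => hx' ?_⟩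
    simpa using hperiodic K (-l) (L.neg_mem hl) _ h
  · rintro x ⟨hx, -⟩
    rw [Set.mem_preimage, add_right_comm, mem_add_segment_zero_iff] at hx
    obtain ⟨s, -, hs⟩ := hx
    rw [Set.mem_preimage, Submodule.coe_sup, ← add_assoc, mem_add_span_singleton_iff]
    exact ⟨-s, by rwa [neg_smul, ← sub_eq_add_neg]⟩
  · rw [Set.mem_preimage, Submodule.coe_sup, ← add_assoc, mem_add_span_singleton_iff] at hx
    have hline := existsUnique_int_smul_mem_add_segment_sdiff (hconv.add W.convex)
      (isCompact_setOf_add_smul_mem_add_submodule hK hu) hx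
    simpa only [Int.cast_smul_eq_zsmul, ← map_zsmul, ← map_add, ← Set.mem_preimage,
      Set.preimage_sdiff, add_right_comm K (W : Set V)] using hline

open Classical in
theorem residueCount_preimage_zonotope (c : Λ →+ V) (u : ι → Λ) (w : V) (R T : Finset ι)
    (hTR : Disjoint T R) (hT : LinearIndepOn ℝ (c ∘ u) (T : Set ι)) :
    residueCount (AddSubgroup.closure (u '' (T : Set ι)))
      (c ⁻¹' ({w} + ∑ i ∈ R, segment ℝ 0 (c (u i)) +
        (Submodule.span ℝ ((c ∘ u) '' (T : Set ι)) : Set V))) =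
    ∑ S ∈ R.powerset, if LinearIndepOn ℝ (c ∘ u) ((T ∪ S : Finset ι) : Set ι) then
      residueCount (AddSubgroup.closure (u '' ((T ∪ S : Finset ι) : Set ι)))
        (c ⁻¹' ({w} + (Submodule.span ℝ ((c ∘ u) '' ((T ∪ S : Finset ι) : Set ι)) : Set V)))
      else 0 := by
  induction R using Finset.induction_on generalizing T with
  | empty => simp [hT]
  | insert a R ha ih =>
    obtain ⟨haT, hTR⟩ := Finset.disjoint_insert_right.mp hTR
    rw [Finset.sum_powerset_insert ha, ← ih T hTR hT, Finset.sum_insert ha,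
      add_comm (segment ℝ 0 (c (u a))), ← add_assoc]
    by_cases hmem : c (u a) ∈ Submodule.span ℝ ((c ∘ u) '' (T : Set ι))
    · have hdep (S : Finset ι) : ¬ LinearIndepOn ℝ (c ∘ u) ((T ∪ insert a S : Finset ι) : Set ι) :=
        fun h => ((linearIndepOn_insert haT).mp (h.mono (by push_cast; grind))).2 hmem
      simp only [add_assoc _ (segment ℝ 0 (c (u a))), segment_zero_add_submodule hmem, hdep,
        if_false, Finset.sum_const_zero, add_zero]
    · have hindep : LinearIndepOn ℝ (c ∘ u) ((insert a T : Finset ι) : Set ι) := by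
        rw [Finset.coe_insert]
        exact hT.insert hmem
      have hlattice : AddSubgroup.closure (u '' (T : Set ι)) ⊔ AddSubgroup.zmultiples (u a) =
          AddSubgroup.closure (u '' ((insert a T : Finset ι) : Set ι)) := by
        rw [Finset.coe_insert, Set.image_insert_eq, Set.insert_eq, AddSubgroup.closure_union,
          ← AddSubgroup.zmultiples_eq_closure, sup_comm]
      have hspan : Submodule.span ℝ ((c ∘ u) '' (T : Set ι)) ⊔ Submodule.span ℝ {c (u a)} =
          Submodule.span ℝ ((c ∘ u) '' ((insert a T : Finset ι) : Set ι)) := by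
        rw [Finset.coe_insert, Set.image_insert_eq, Submodule.span_insert, sup_comm,
          Function.comp_apply]
      rw [residueCount_preimage_add_segment (isCompact_singleton.add (isCompact_sum_segment _ R))
        ((convex_singleton w).add (convex_sum _ fun i _ => convex_segment _ _))
        (fun l hl => map_mem_span_of_mem_closure hl) hmem,
        hlattice, hspan, ih (insert a T) (Finset.disjoint_insert_left.mpr ⟨ha, hTR⟩) hindep]
      simp only [Finset.insert_union, Finset.union_insert]

open Classical in
theorem encard_preimage_zonotope (c : Λ →+ V) (u : ι → Λ) (w : V) (R : Finset ι) :
    (c ⁻¹' ({w} + ∑ i ∈ R, segment ℝ 0 (c (u i)))).encard =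
    ∑ S ∈ R.powerset, if LinearIndepOn ℝ (c ∘ u) (S : Set ι) then
      residueCount (AddSubgroup.closure (u '' (S : Set ι)))
        (c ⁻¹' ({w} + (Submodule.span ℝ ((c ∘ u) '' (S : Set ι)) : Set V))) else 0 := by
  simpa [residueCount_bot] using
    residueCount_preimage_zonotope c u w R ∅ (Finset.disjoint_empty_left R) (by simp)

end Zonotope

section Dilation

variable {Λ ι : Type*} [AddCommGroup Λ]

theorem relIndex_map_nsmul (M : AddSubgroup Λ) [Module.Free ℤ M] [Module.Finite ℤ M] (t : ℕ) :
    (M.map (nsmulAddMonoidHom t)).relIndex M = t ^ Module.finrank ℤ M := by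
  rw [← AddSubgroup.index_range_nsmul M t, AddSubgroup.relIndex]
  congr 1
  ext x
  simp [AddSubgroup.mem_addSubgroupOf, AddSubgroup.mem_map, Subtype.ext_iff]

theorem relIndex_closure_nsmul (u : ι → Λ) (S : Finset ι) (hS : LinearIndepOn ℤ u (S : Set ι))
    (t : ℕ) :
    (AddSubgroup.closure ((fun i => t • u i) '' (S : Set ι))).relIndex
      (AddSubgroup.closure (u '' (S : Set ι))) = t ^ S.card := by
  have hspan : (Submodule.span ℤ (Set.range fun i : (S : Set ι) => u i)).toAddSubgroup =
      AddSubgroup.closure (u '' (S : Set ι)) := by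
    rw [← Set.image_eq_range, Submodule.span_int_eq_addSubgroupClosure]
  have hmap : AddSubgroup.closure ((fun i => t • u i) '' (S : Set ι)) =
      (AddSubgroup.closure (u '' (S : Set ι))).map (nsmulAddMonoidHom t) := by
    rw [AddMonoidHom.map_closure, Set.image_image]
    rfl
  let b := Module.Basis.span hS.linearIndependent
  have : Module.Free ℤ (Submodule.span ℤ (Set.range fun i : (S : Set ι) => u i)) := .of_basis b
  have : Module.Finite ℤ (Submodule.span ℤ (Set.range fun i : (S : Set ι) => u i)) := .of_basis b
  rw [hmap, ← hspan]
  refine (relIndex_map_nsmul _ t).trans (congrArg (t ^ ·) ?_)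
  exact (Module.finrank_eq_card_basis b).trans (Fintype.card_coe S)

end Dilation

/-! ### Cycles of signed graphs -/

section SimpleGraph

variable {V : Type*} {G H : SimpleGraph V}

theorem connected_of_forall_adj_reachable (hG : G.Connected)
    (h : ∀ i j, G.Adj i j → H.Reachable i j) : H.Connected := by
  have := hG.nonempty
  refine .mk fun i j => ?_
  obtain ⟨w⟩ := hG.preconnected i j
  induction w with
  | nil => rfl
  | cons hij _ ih => exact (h _ _ hij).trans ih

theorem reachable_of_forall_ne_adj_add_one {m : ℕ} [NeZero m] {v : ZMod m → V} {i₀ : ZMod m}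
    (h : ∀ i, i ≠ i₀ → G.Adj (v i) (v (i + 1))) : G.Reachable (v (i₀ + 1)) (v i₀) := by
  have hround (k : ℕ) (hk : k < m) : G.Reachable (v (i₀ + 1)) (v (i₀ + 1 + k)) := by
    induction k with
    | zero => simp
    | succ k ih =>
      rw [Nat.cast_succ, ← add_assoc]
      refine (ih (by omega)).trans (h _ fun heq => ?_).reachable
      rw [add_assoc, add_eq_left, add_comm, ← Nat.cast_succ, ZMod.natCast_eq_zero_iff] at heq
      exact absurd (Nat.le_of_dvd (by omega) heq) (by omega)
  have hlast := hround (m - 1) (Nat.sub_one_lt (NeZero.ne m))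
  rwa [add_assoc, add_comm 1, ← Nat.cast_succ, Nat.succ_eq_add_one,
    Nat.sub_one_add_one (NeZero.ne m), ZMod.natCast_self, add_zero] at hlast

theorem getVert_zmod_val_add_one {a : V} {w : G.Walk a a} (hw : 1 < w.length)
    (k : ZMod w.length) : w.getVert (k + 1).val = w.getVert (k.val + 1) := by
  have : NeZero w.length := ⟨by omega⟩
  have : Fact (1 < w.length) := ⟨hw⟩
  rcases (Nat.succ_le_of_lt k.val_lt).eq_or_lt with hlast | hlt
  · have hzero : k + 1 = 0 := by
      rw [← ZMod.natCast_zmod_val k, ← Nat.cast_succ, hlast, ZMod.natCast_self]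
    rw [hzero, ZMod.val_zero, ← Nat.succ_eq_add_one, hlast, w.getVert_zero, w.getVert_length]
  · rw [ZMod.val_add_of_lt (by rwa [ZMod.val_one]), ZMod.val_one]

theorem injective_sym2_add_one {m : ℕ} (hm : 3 ≤ m) {v : ZMod m → V} (hv : v.Injective) :
    Function.Injective fun i => s(v i, v (i + 1)) := by
  intro k l hkl
  rcases Sym2.eq_iff.mp hkl with ⟨h, -⟩ | ⟨h₁, h₂⟩
  · exact hv h
  · have htwo : ((2 : ℕ) : ZMod m) = 0 := by
      have := hv h₂
      rwa [hv h₁, add_assoc, add_eq_left, one_add_one_eq_two] at this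
    rw [ZMod.natCast_eq_zero_iff] at htwo
    exact absurd (Nat.le_of_dvd two_pos htwo) (by omega)

end SimpleGraph

namespace SignedGraph

variable {V : Type*} {G : SignedGraph V} {C : Set (Sym2 V × ℤˣ)} {e : Sym2 V × ℤˣ}

theorem mem_edges_iff {i j : V} {σ : ℤˣ} :
    (s(i, j), σ) ∈ G.edges ↔ (G.pos.Adj i j ∧ σ = 1) ∨ (G.neg.Adj i j ∧ σ = -1) :=
  Iff.rfl

theorem ne_of_mem_edges {i j : V} {σ : ℤˣ} (h : (s(i, j), σ) ∈ G.edges) : i ≠ j := by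
  rcases mem_edges_iff.mp h with ⟨h, -⟩ | ⟨h, -⟩ <;> exact h.ne

theorem underlying_adj_iff {i j : V} :
    G.underlying.Adj i j ↔ ∃ σ, (s(i, j), σ) ∈ G.edges := by
  simp only [mem_edges_iff, underlying, SimpleGraph.sup_adj, exists_or, exists_and_left,
    exists_eq, and_true]

theorem image_fst_edges : Prod.fst '' G.edges = G.underlying.edgeSet := by
  ext p
  induction p using Sym2.ind with
  | _ i j => simp [underlying_adj_iff]

theorem Connected.card_le_ncard_edges_add_one [Finite V] (hG : G.Connected) :
    Nat.card V ≤ G.edges.ncard + 1 := by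
  have h := SimpleGraph.Connected.card_vert_le_card_edgeSet_add_one hG
  rw [← image_fst_edges, Nat.card_coe_set_eq] at h
  exact h.trans (Nat.add_le_add_right (Set.ncard_image_le (Set.toFinite _)) 1)

theorem exists_isCycle_of_parallel {i j : V} (hpos : (s(i, j), 1) ∈ G.edges)
    (hneg : (s(i, j), -1) ∈ G.edges) : ∃ C, G.IsCycle C := by
  have hne := ne_of_mem_edges hpos
  refine ⟨_, 2, (![i, j] : Fin 2 → V), (![1, -1] : Fin 2 → ℤˣ), le_rfl, ?_, ?_, ?_, rfl⟩
  · intro a b hab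
    fin_cases a <;> fin_cases b <;> first | rfl | simp_all
  · intro a b hab
    have hab' := congrArg Prod.snd hab
    fin_cases a <;> fin_cases b <;> first | rfl | simp_all
  · intro a
    fin_cases a
    · exact hpos
    · exact Sym2.eq_swap ▸ hneg

theorem exists_isCycle_of_walk {a : V} {w : G.underlying.Walk a a} (hw : w.IsCycle) :
    ∃ C, G.IsCycle C := by
  have hthree := hw.three_le_length
  have : NeZero w.length := ⟨by omega⟩
  have hadj (k : ZMod w.length) :
      G.underlying.Adj (w.getVert k.val) (w.getVert (k + 1).val) := by
    rw [getVert_zmod_val_add_one (by omega)]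
    exact w.adj_getVert_succ k.val_lt
  choose σ hσ using fun k => underlying_adj_iff.mp (hadj k)
  have hinj : Function.Injective fun k : ZMod w.length => w.getVert k.val := by
    intro k l hkl
    have hk := k.val_lt
    have hl := l.val_lt
    exact ZMod.val_injective _ (hw.getVert_injOn' (by grind) (by grind) hkl)
  exact ⟨_, w.length, _, σ, by omega, hinj,
    fun k l hkl => injective_sym2_add_one hthree hinj (congrArg Prod.fst hkl), hσ, rfl⟩

theorem injOn_fst_edges (h : ∀ C, ¬ G.IsCycle C) : Set.InjOn Prod.fst G.edges := by
  rintro ⟨p, σ⟩ hp ⟨q, τ⟩ hq hpq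
  obtain rfl : p = q := hpq
  induction p using Sym2.ind with
  | _ i j =>
    rcases Int.units_eq_one_or σ with rfl | rfl <;> rcases Int.units_eq_one_or τ with rfl | rfl
    · rfl
    · exact ((exists_isCycle_of_parallel hp hq).elim h).elim
    · exact ((exists_isCycle_of_parallel hq hp).elim h).elim
    · rfl

theorem Connected.ncard_edges_of_forall_not_isCycle [Finite V] (hG : G.Connected)
    (h : ∀ C, ¬ G.IsCycle C) : G.edges.ncard + 1 = Nat.card V := by
  have hacyclic : G.underlying.IsAcyclic := fun _ _ hw =>
    (exists_isCycle_of_walk hw).elim fun C hC => h C hC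
  rw [← (SimpleGraph.isTree_iff_connected_and_card.mp ⟨hG, hacyclic⟩).2, ← image_fst_edges,
    Nat.card_coe_set_eq, (injOn_fst_edges h).ncard_image]

/-- The signed graph with the edge `e` removed. -/
def deleteEdge (G : SignedGraph V) (e : Sym2 V × ℤˣ) : SignedGraph V where
  pos := G.pos.deleteEdges {p | (p, 1) = e}
  neg := G.neg.deleteEdges {p | (p, -1) = e}
  half := G.half
  loop := G.loop

theorem edges_deleteEdge : (G.deleteEdge e).edges = G.edges \ {e} := by
  ext ⟨p, σ⟩
  simp only [edges, deleteEdge, SimpleGraph.edgeSet_deleteEdges, Set.mem_sdiff,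
    Set.mem_ofPred_eq, Set.mem_singleton_iff]
  grind

theorem mem_edges_deleteEdge_iff {f : Sym2 V × ℤˣ} :
    f ∈ (G.deleteEdge e).edges ↔ f ∈ G.edges ∧ f ≠ e := by
  rw [edges_deleteEdge, Set.mem_sdiff, Set.mem_singleton_iff]

theorem ncard_edges_deleteEdge [Finite V] (he : e ∈ G.edges) :
    (G.deleteEdge e).edges.ncard + 1 = G.edges.ncard := by
  rw [edges_deleteEdge, Set.ncard_sdiff_singleton_add_one he (Set.toFinite _)]

theorem IsCycle.subset_edges (hC : G.IsCycle C) : C ⊆ G.edges := by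
  obtain ⟨m, v, s, -, -, -, hs, rfl⟩ := hC
  rintro _ ⟨i, rfl⟩
  exact hs i

theorem IsCycle.nonempty (hC : G.IsCycle C) : C.Nonempty := by
  obtain ⟨m, v, s, -, -, -, -, rfl⟩ := hC
  exact Set.range_nonempty _

theorem isCycle_deleteEdge_iff : (G.deleteEdge e).IsCycle C ↔ G.IsCycle C ∧ e ∉ C := by
  constructor
  · intro hC
    refine ⟨?_, fun he => (mem_edges_deleteEdge_iff.mp (hC.subset_edges he)).2 rfl⟩
    obtain ⟨m, v, s, hm, hv, hinj, hs, hC⟩ := hC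
    exact ⟨m, v, s, hm, hv, hinj, fun i => (mem_edges_deleteEdge_iff.mp (hs i)).1, hC⟩
  · rintro ⟨⟨m, v, s, hm, hv, hinj, hs, rfl⟩, he⟩
    exact ⟨m, v, s, hm, hv, hinj,
      fun i => mem_edges_deleteEdge_iff.mpr ⟨hs i, fun h => he ⟨i, h⟩⟩, rfl⟩

theorem Connected.deleteEdge (hG : G.Connected) (hC : G.IsCycle C) (he : e ∈ C) :
    (G.deleteEdge e).Connected := by
  obtain ⟨m, v, s, hm, -, hinj, hs, rfl⟩ := hC
  obtain ⟨i₀, rfl⟩ := he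
  have : NeZero m := ⟨by omega⟩
  have hdetour : (G.deleteEdge (s(v i₀, v (i₀ + 1)), s i₀)).underlying.Reachable
      (v (i₀ + 1)) (v i₀) :=
    reachable_of_forall_ne_adj_add_one fun i hi => underlying_adj_iff.mpr
      ⟨s i, mem_edges_deleteEdge_iff.mpr ⟨hs i, hinj.ne hi⟩⟩
  refine connected_of_forall_adj_reachable hG fun i j hij => ?_
  obtain ⟨σ, hσ⟩ := underlying_adj_iff.mp hij
  by_cases h : (s(i, j), σ) = (s(v i₀, v (i₀ + 1)), s i₀)
  · rcases Sym2.eq_iff.mp (congrArg Prod.fst h) with ⟨rfl, rfl⟩ | ⟨rfl, rfl⟩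
    · exact hdetour.symm
    · exact hdetour
  · exact (underlying_adj_iff.mpr ⟨σ, mem_edges_deleteEdge_iff.mpr ⟨hσ, h⟩⟩).reachable

theorem isBalancedCycle_iff_prod {m : ℕ} [NeZero m] {v : ZMod m → V} {s : ZMod m → ℤˣ}
    (hinj : Function.Injective fun i => (s(v i, v (i + 1)), s i)) :
    IsBalancedCycle (Set.range fun i => (s(v i, v (i + 1)), s i)) ↔ ∏ i, s i = 1 := by
  classical
  have himage : {e ∈ Set.range fun i => (s(v i, v (i + 1)), s i) | e.2 = -1} =
      (fun i => (s(v i, v (i + 1)), s i)) '' {i | s i = -1} := by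
    ext e
    constructor
    · rintro ⟨⟨i, rfl⟩, h⟩
      exact ⟨i, h, rfl⟩
    · rintro ⟨i, h, rfl⟩
      exact ⟨⟨i, rfl⟩, h⟩
  have hprod : ∏ i, s i = (-1) ^ (Finset.univ.filter fun i => s i = -1).card := by
    rw [← Finset.prod_const, Finset.prod_filter]
    refine Finset.prod_congr rfl fun i _ => ?_
    rcases Int.units_eq_one_or (s i) with h | h <;> simp [h]
  rw [IsBalancedCycle, himage, Set.ncard_image_of_injective _ hinj, Set.ncard_eq_toFinset_card',
    Set.toFinset_ofPred, hprod, neg_one_pow_eq_one_iff_even (by decide)]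

/-- `ε` switches all edges of `G` to positive ones. -/
def SwitchedBy (G : SignedGraph V) (ε : V → ℤˣ) : Prop :=
  ∀ i j σ, (s(i, j), σ) ∈ G.edges → ε i = σ * ε j

/-- `G` has no halfedges and no loops, and some switching makes all its edges positive. -/
def Balanced (G : SignedGraph V) : Prop :=
  (∃ ε, G.SwitchedBy ε) ∧ G.half = ∅ ∧ G.loop = ∅

theorem eq_sign_mul_comm {a b σ : ℤˣ} : a = σ * b ↔ b = σ * a := by
  constructor <;> rintro rfl <;> rw [← mul_assoc, Int.units_mul_self, one_mul]

theorem prod_eq_mul_of_forall_ne {m : ℕ} [NeZero m] {s ε : ZMod m → ℤˣ} {i₀ : ZMod m}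
    (h : ∀ i, i ≠ i₀ → ε i = s i * ε (i + 1)) : ∏ i, s i = s i₀ * (ε i₀ * ε (i₀ + 1)) := by
  have htelescope : ∏ i, s i = ∏ i, s i * (ε i * ε (i + 1)) := by
    have hshift : ∏ i, ε (i + 1) = ∏ i, ε i :=
      Equiv.prod_comp (Equiv.addRight (1 : ZMod m)) ε
    rw [Finset.prod_mul_distrib, Finset.prod_mul_distrib, hshift, Int.units_mul_self, mul_one]
  rw [htelescope]
  refine Finset.prod_eq_single i₀ (fun i _ hi => ?_) (by simp)
  rw [h i hi, mul_assoc, Int.units_mul_self, mul_one, Int.units_mul_self]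

theorem SwitchedBy.isBalancedCycle {ε : V → ℤˣ} (hε : G.SwitchedBy ε) (hC : G.IsCycle C) :
    IsBalancedCycle C := by
  obtain ⟨m, v, s, hm, -, hinj, hs, rfl⟩ := hC
  have : NeZero m := ⟨by omega⟩
  have hstep (i : ZMod m) : ε (v i) = s i * ε (v (i + 1)) := hε _ _ _ (hs i)
  rw [isBalancedCycle_iff_prod hinj, prod_eq_mul_of_forall_ne (i₀ := 0) fun i _ => hstep i,
    hstep 0, mul_assoc, Int.units_mul_self, mul_one, Int.units_mul_self]

theorem SwitchedBy.of_deleteEdge {ε : V → ℤˣ} (hC : G.IsCycle C) (hbal : IsBalancedCycle C)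
    (he : e ∈ C) (hε : (G.deleteEdge e).SwitchedBy ε) : G.SwitchedBy ε := by
  obtain ⟨m, v, s, hm, -, hinj, hs, rfl⟩ := hC
  have : NeZero m := ⟨by omega⟩
  obtain ⟨i₀, rfl⟩ := he
  have hstep (i : ZMod m) (hi : i ≠ i₀) : ε (v i) = s i * ε (v (i + 1)) :=
    hε _ _ _ (mem_edges_deleteEdge_iff.mpr ⟨hs i, hinj.ne hi⟩)
  have hdeleted : ε (v i₀) = s i₀ * ε (v (i₀ + 1)) := by
    have hprod := (isBalancedCycle_iff_prod hinj).mp hbal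
    rwa [prod_eq_mul_of_forall_ne hstep, ← mul_assoc, mul_eq_one_iff_eq_inv,
      Int.units_inv_eq_self, eq_comm, eq_sign_mul_comm] at hprod
  intro i j σ hσ
  by_cases h : (s(i, j), σ) = (s(v i₀, v (i₀ + 1)), s i₀)
  · obtain ⟨hij, rfl⟩ := Prod.mk.inj h
    rcases Sym2.eq_iff.mp hij with ⟨rfl, rfl⟩ | ⟨rfl, rfl⟩
    · exact hdeleted
    · exact eq_sign_mul_comm.mp hdeleted
  · exact hε _ _ _ (mem_edges_deleteEdge_iff.mpr ⟨hσ, h⟩)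

end SignedGraph

/-! ### The lattice and the subspace spanned by a signed graph -/

/-- The inclusion of the lattice `ℤⁿ` into `ℝⁿ`. -/
noncomputable def latticeCast (V : Type*) : (V → ℤ) →+ (V → ℝ) := (Int.castAddHom ℝ).compLeft V

@[simp]
theorem latticeCast_apply {V : Type*} (x : V → ℤ) (v : V) : latticeCast V x v = (x v : ℝ) := rfl

namespace SignedGraph

section ComponentBalance

variable {V : Type*} {G : SignedGraph V}

/-- The signed graph carried by the vertex set `S` (in the applications a union of components) is
balanced. -/
def BalancedOn (G : SignedGraph V) (S : Set V) : Prop :=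
  (∃ ε : V → ℤˣ, ∀ i ∈ S, ∀ j σ, (s(i, j), σ) ∈ G.edges → ε i = σ * ε j) ∧
    ∀ v ∈ S, v ∉ G.half ∧ v ∉ G.loop

theorem balanced_iff_balancedOn_univ : G.Balanced ↔ G.BalancedOn Set.univ := by
  simp only [Balanced, BalancedOn, SwitchedBy, Set.mem_univ, true_imp_iff, forall_and,
    Set.eq_empty_iff_forall_notMem]

theorem mem_edges_component_iff {c : G.underlying.ConnectedComponent} {i j : c.supp} {σ : ℤˣ} :
    (s(i, j), σ) ∈ (G.component c).edges ↔ (s((i : V), (j : V)), σ) ∈ G.edges := by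
  rw [mem_edges_iff, mem_edges_iff]
  rfl

theorem half_component_eq_empty_iff {c : G.underlying.ConnectedComponent} :
    (G.component c).half = ∅ ↔ ∀ v ∈ c.supp, v ∉ G.half := by
  rw [Set.eq_empty_iff_forall_notMem]
  exact Subtype.forall

theorem loop_component_eq_empty_iff {c : G.underlying.ConnectedComponent} :
    (G.component c).loop = ∅ ↔ ∀ v ∈ c.supp, v ∉ G.loop := by
  rw [Set.eq_empty_iff_forall_notMem]
  exact Subtype.forall

theorem connectedComponentMk_eq_of_mem_edges {i j : V} {σ : ℤˣ} (h : (s(i, j), σ) ∈ G.edges) :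
    G.underlying.connectedComponentMk i = G.underlying.connectedComponentMk j :=
  SimpleGraph.ConnectedComponent.connectedComponentMk_eq_of_adj
    (underlying_adj_iff.mpr ⟨σ, h⟩)

theorem exists_switchedBy_component_iff {c : G.underlying.ConnectedComponent} :
    (∃ ε, (G.component c).SwitchedBy ε) ↔
      ∃ ε : V → ℤˣ, ∀ i ∈ c.supp, ∀ j σ, (s(i, j), σ) ∈ G.edges → ε i = σ * ε j := by
  classical
  constructor
  · rintro ⟨ε, h⟩
    refine ⟨fun v => if hv : v ∈ c.supp then ε ⟨v, hv⟩ else 1, fun i hi j σ hσ => ?_⟩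
    have hj : j ∈ c.supp := (connectedComponentMk_eq_of_mem_edges hσ).symm.trans hi
    simp only [dif_pos hi, dif_pos hj]
    exact h _ _ _ (mem_edges_component_iff.mpr hσ)
  · rintro ⟨ε, h⟩
    exact ⟨fun v => ε v, fun i j σ hσ => h i i.2 j σ (mem_edges_component_iff.mp hσ)⟩

theorem component_balanced_iff {c : G.underlying.ConnectedComponent} :
    (G.component c).Balanced ↔ G.BalancedOn c.supp := by
  simp only [Balanced, BalancedOn, half_component_eq_empty_iff, loop_component_eq_empty_iff,
    exists_switchedBy_component_iff, forall_and]

end ComponentBalance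

/-- A cell is a signed edge, a halfedge or a loop on the vertex set `V`. -/
abbrev Cell (V : Type*) := (Sym2 V × ℤˣ) ⊕ V ⊕ V

/-- The cells of `G`. -/
def cells {V : Type*} (G : SignedGraph V) : Set (Cell V) :=
  {x | Sum.elim (· ∈ G.edges) (Sum.elim (· ∈ G.half) (· ∈ G.loop)) x}

theorem ncard_cells {V : Type*} [Finite V] (G : SignedGraph V) :
    G.cells.ncard = G.edges.ncard + (G.half.ncard + G.loop.ncard) := by
  have h : G.cells = Sum.inl '' G.edges ∪
      (Sum.inr '' (Sum.inl '' G.half) ∪ Sum.inr '' (Sum.inr '' G.loop)) := by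
    ext (x | x | x) <;> simp [cells]
  rw [h, Set.ncard_union_eq (by rw [Set.disjoint_left]; rintro _ ⟨x, -, rfl⟩; simp),
    Set.ncard_union_eq (by rw [Set.disjoint_left]; rintro _ ⟨_, ⟨x, -, rfl⟩, rfl⟩; simp),
    Set.ncard_image_of_injective _ Sum.inl_injective,
    Set.ncard_image_of_injective _ Sum.inr_injective,
    Set.ncard_image_of_injective _ Sum.inr_injective,
    Set.ncard_image_of_injective _ Sum.inl_injective,
    Set.ncard_image_of_injective _ Sum.inr_injective]

section Labeling

variable {V M : Type*} [AddCommGroup M] {G : SignedGraph V} {f : V → M}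

/-- Vertex labels satisfying the relations encoded by the cells of `G`. When `V` is finite they
amount to homomorphisms to `M` from the quotient of `ℤ^V` by the lattice spanned by `G`. -/
structure IsLabeling (G : SignedGraph V) (f : V → M) : Prop where
  edge : ∀ i j σ, (s(i, j), σ) ∈ G.edges → f i = σ • f j
  half : ∀ v ∈ G.half, f v = 0
  loop : ∀ v ∈ G.loop, (2 : ℤ) • f v = 0

theorem IsLabeling.exists_eq_smul (hf : G.IsLabeling f) {i j : V}
    (h : G.underlying.Reachable i j) : ∃ η : ℤˣ, f j = η • f i := by
  obtain ⟨w⟩ := h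
  induction w with
  | nil => exact ⟨1, (one_smul _ _).symm⟩
  | @cons i k j hik _ ih =>
    obtain ⟨η, hη⟩ := ih
    obtain ⟨σ, hσ⟩ := underlying_adj_iff.mp hik
    exact ⟨η * σ, by rw [hη, hf.edge k i σ (Sym2.eq_swap ▸ hσ), mul_smul]⟩

theorem units_eq_of_smul_eq {m : M} (hm : (2 : ℤ) • m ≠ 0) {η θ : ℤˣ} (h : η • m = θ • m) :
    η = θ := by
  have hm' : m ≠ -m := fun h' => hm (by rw [two_smul, ← eq_neg_iff_add_eq_zero]; exact h')
  rcases Int.units_eq_one_or η with rfl | rfl <;> rcases Int.units_eq_one_or θ with rfl | rfl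
  · rfl
  · exact absurd (by simpa using h) hm'
  · exact absurd (by simpa using h.symm) hm'
  · rfl

theorem IsLabeling.switches (hf : G.IsLabeling f) {r : V} (hr : (2 : ℤ) • f r ≠ 0) {i j : V}
    {σ η θ : ℤˣ} (hi : f i = η • f r) (hj : f j = θ • f r) (h : (s(i, j), σ) ∈ G.edges) :
    η = σ * θ :=
  units_eq_of_smul_eq hr (by rw [← hi, hf.edge i j σ h, hj, mul_smul])

theorem IsLabeling.balancedOn (hf : G.IsLabeling f) {r : V} (hr : (2 : ℤ) • f r ≠ 0) {S : Set V}
    (hS : ∀ v ∈ S, G.underlying.Reachable r v) : G.BalancedOn S := by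
  have hex : ∀ v, ∃ η : ℤˣ, G.underlying.Reachable r v → f v = η • f r := fun v => by
    by_cases h : G.underlying.Reachable r v
    · exact (hf.exists_eq_smul h).imp fun _ hη _ => hη
    · exact ⟨1, fun h' => absurd h' h⟩
  choose η hη using hex
  have hne : ∀ v ∈ S, (2 : ℤ) • f v ≠ 0 := fun v hv => by
    rw [hη v (hS v hv), smul_comm, smul_ne_zero_iff_ne]
    exact hr
  refine ⟨⟨η, fun i hi j σ hσ => ?_⟩, fun v hv => ⟨fun h => hne v hv ?_, fun h => hne v hv ?_⟩⟩
  · have hj := (hS i hi).trans (underlying_adj_iff.mpr ⟨σ, hσ⟩).reachable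
    exact hf.switches hr (hη i (hS i hi)) (hη j hj) hσ
  · rw [hf.half v h, smul_zero]
  · exact hf.loop v h

theorem IsLabeling.two_smul_eq_zero_of_not_balanced (hf : G.IsLabeling f)
    {c : G.underlying.ConnectedComponent} (hc : ¬ (G.component c).Balanced) {r : V}
    (hr : r ∈ c.supp) : (2 : ℤ) • f r = 0 := by
  by_contra h
  refine hc (component_balanced_iff.mpr (hf.balancedOn h fun v hv => ?_))
  exact SimpleGraph.ConnectedComponent.exact (Eq.trans hr (Eq.symm hv))

end Labeling

section Lattice

variable {V : Type*} [LinearOrder V] {G : SignedGraph V}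

/-- The vector encoded by a cell. -/
def cellVec : Cell V → V → ℤ
  | .inl (p, σ) => Pi.single p.inf 1 - Pi.single p.sup (σ : ℤ)
  | .inr (.inl v) => Pi.single v 1
  | .inr (.inr v) => Pi.single v 2

theorem cellVec_mk_of_le {i j : V} (h : i ≤ j) (σ : ℤˣ) :
    cellVec (.inl (s(i, j), σ)) = Pi.single i 1 - Pi.single j (σ : ℤ) := by
  simp [cellVec, h]

/-- The lattice spanned by the vectors of the cells of `G`. -/
def lattice (G : SignedGraph V) : AddSubgroup (V → ℤ) :=
  AddSubgroup.closure (cellVec '' G.cells)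

/-- The real subspace spanned by the vectors of the cells of `G`. -/
noncomputable def realSpan (G : SignedGraph V) : Submodule ℝ (V → ℝ) :=
  Submodule.span ℝ ((latticeCast V ∘ cellVec) '' G.cells)

theorem latticeCast_mem_realSpan {x : V → ℤ} (hx : x ∈ G.lattice) :
    latticeCast V x ∈ G.realSpan :=
  map_mem_span_of_mem_closure hx

/-- The class of the standard basis vector of `v` modulo the lattice of `G`; as a function of `v`
this is the universal labeling of `G`. -/
def latticeClass (G : SignedGraph V) (v : V) : (V → ℤ) ⧸ G.lattice :=
  (Pi.single v 1 : V → ℤ)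

/-- The class of the standard basis vector of `v` modulo the real span of `G`. -/
noncomputable def realClass (G : SignedGraph V) (v : V) : (V → ℝ) ⧸ G.realSpan :=
  G.realSpan.mkQ (Pi.single v 1)

theorem isLabeling_map_single {M : Type*} [AddCommGroup M] {φ : (V → ℤ) →+ M}
    (hφ : ∀ e ∈ G.cells, φ (cellVec e) = 0) : G.IsLabeling fun v => φ (Pi.single v 1) := by
  have hsingle : ∀ (v : V) (k : ℤ), φ (Pi.single v k) = k • φ (Pi.single v 1) := fun v k => by
    rw [← map_zsmul, ← Pi.single_smul', smul_eq_mul, mul_one]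
  have hle : ∀ {i j : V} {σ : ℤˣ}, i ≤ j → (s(i, j), σ) ∈ G.edges →
      φ (Pi.single i 1) = σ • φ (Pi.single j 1) := fun {i j σ} hij h => by
    rw [← sub_eq_zero, Units.smul_def, ← hsingle, ← map_sub, ← cellVec_mk_of_le hij]
    exact hφ _ h
  refine ⟨fun i j σ h => ?_, fun v hv => hφ (.inr (.inl v)) hv, fun v hv => ?_⟩
  · rcases le_total i j with hij | hij
    · exact hle hij h
    · rw [hle hij (Sym2.eq_swap ▸ h), ← mul_smul, Int.units_mul_self, one_smul]
  · rw [← hsingle]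
    exact hφ (.inr (.inr v)) hv

theorem isLabeling_latticeClass (G : SignedGraph V) : G.IsLabeling G.latticeClass :=
  isLabeling_map_single (φ := QuotientAddGroup.mk' G.lattice) fun e he =>
    (QuotientAddGroup.eq_zero_iff _).mpr (AddSubgroup.subset_closure ⟨e, he, rfl⟩)

theorem isLabeling_realClass (G : SignedGraph V) : G.IsLabeling G.realClass := by
  have h := isLabeling_map_single (G := G)
    (φ := G.realSpan.mkQ.toAddMonoidHom.comp (latticeCast V)) fun e he =>
      (Submodule.Quotient.mk_eq_zero _).mpr (Submodule.subset_span ⟨e, he, rfl⟩)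
  convert h using 2 with v
  change G.realSpan.mkQ _ = G.realSpan.mkQ _
  congr 1
  ext w
  simp [Pi.single_apply, apply_ite (Int.cast : ℤ → ℝ)]

theorem realClass_eq_zero_of_not_balanced {c : G.underlying.ConnectedComponent}
    (hc : ¬ (G.component c).Balanced) {r : V} (hr : r ∈ c.supp) : G.realClass r = 0 := by
  have h := G.isLabeling_realClass.two_smul_eq_zero_of_not_balanced hc hr
  rw [← Int.cast_smul_eq_zsmul ℝ] at h
  exact (smul_eq_zero.mp h).resolve_left (by norm_num)

section Fintype

variable [Fintype V]

theorem mk_eq_linearCombination_latticeClass (G : SignedGraph V) (x : V → ℤ) :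
    (x : (V → ℤ) ⧸ G.lattice) = Fintype.linearCombination ℤ G.latticeClass x := by
  conv_lhs => rw [← Finset.univ_sum_single x]
  rw [Fintype.linearCombination_apply, ← QuotientAddGroup.mk'_apply, map_sum]
  refine Finset.sum_congr rfl fun v _ => ?_
  rw [latticeClass, ← QuotientAddGroup.mk'_apply, ← map_zsmul, ← Pi.single_smul', smul_eq_mul,
    mul_one]

theorem mkQ_eq_linearCombination_realClass (G : SignedGraph V) (y : V → ℝ) :
    G.realSpan.mkQ y = Fintype.linearCombination ℝ G.realClass y := by
  conv_lhs => rw [← Finset.univ_sum_single y]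
  rw [Fintype.linearCombination_apply, map_sum]
  refine Finset.sum_congr rfl fun v _ => ?_
  rw [realClass, ← map_smul, ← Pi.single_smul', smul_eq_mul, mul_one]

section LinearCombination

variable {R M : Type*} [Ring R] [AddCommGroup M] [Module R M] {f : V → M}

theorem linearCombination_single_intCast (v : V) (k : ℤ) :
    Fintype.linearCombination R f (fun w => ((Pi.single v k : V → ℤ) w : R)) = k • f v := by
  simp [Fintype.linearCombination_apply, Pi.single_apply, Int.cast_smul_eq_zsmul]

theorem IsLabeling.linearCombination_cellVec (hf : G.IsLabeling f) {e : Cell V}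
    (he : e ∈ G.cells) : Fintype.linearCombination R f (fun v => (cellVec e v : R)) = 0 := by
  rcases e with ⟨p, σ⟩ | v | v
  · induction p using Sym2.ind with
    | _ i j =>
      have hle : ∀ {i j : V}, i ≤ j → (s(i, j), σ) ∈ G.edges →
          Fintype.linearCombination R f (fun v => (cellVec (.inl (s(i, j), σ)) v : R)) = 0 := by
        intro i j hij h
        simp only [cellVec_mk_of_le hij, Pi.sub_apply, Int.cast_sub]
        rw [← Pi.sub_def, map_sub, linearCombination_single_intCast,
          linearCombination_single_intCast, one_smul, ← Units.smul_def, hf.edge i j σ h, sub_self]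
      rcases le_total i j with hij | hij
      · exact hle hij he
      · rw [Sym2.eq_swap] at he ⊢
        exact hle hij he
  · exact (linearCombination_single_intCast v 1).trans (by rw [one_smul, hf.half v he])
  · exact (linearCombination_single_intCast v 2).trans (hf.loop v he)

theorem IsLabeling.linearCombination_intCast_eq_zero (hf : G.IsLabeling f) {x : V → ℤ}
    (hx : x ∈ G.lattice) : Fintype.linearCombination R f (fun v => (x v : R)) = 0 := by
  let φ : (V → ℤ) →+ M :=
    (Fintype.linearCombination R f).toAddMonoidHom.comp ((Int.castAddHom R).compLeft V)
  have hle : G.lattice ≤ φ.ker := (AddSubgroup.closure_le _).mpr <| by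
    rintro _ ⟨e, he, rfl⟩
    exact hf.linearCombination_cellVec he
  exact hle hx

end LinearCombination

theorem IsLabeling.linearCombination_eq_zero_of_mem_realSpan {M : Type*} [AddCommGroup M]
    [Module ℝ M] {f : V → M} (hf : G.IsLabeling f) {y : V → ℝ} (hy : y ∈ G.realSpan) :
    Fintype.linearCombination ℝ f y = 0 := by
  have hle : G.realSpan ≤ (Fintype.linearCombination ℝ f).ker := Submodule.span_le.mpr <| by
    rintro _ ⟨e, he, rfl⟩
    exact hf.linearCombination_cellVec he
  exact hle hy

end Fintype

theorem realSpan_eq_top_of_forall_realClass_eq_zero [Finite V] (h : ∀ v, G.realClass v = 0) :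
    G.realSpan = ⊤ := by
  cases nonempty_fintype V
  exact eq_top_iff.mpr fun y _ => by
    rw [← Submodule.ker_mkQ G.realSpan, LinearMap.mem_ker, mkQ_eq_linearCombination_realClass,
      Fintype.linearCombination_apply]
    exact Finset.sum_eq_zero fun v _ => by rw [h v, smul_zero]

theorem finrank_realSpan_le_ncard_cells [Finite V] (G : SignedGraph V) :
    Module.finrank ℝ G.realSpan ≤ G.cells.ncard := by
  have : Fintype ((latticeCast V ∘ cellVec) '' G.cells) := Fintype.ofFinite _
  refine (finrank_span_le_card _).trans ?_
  rw [← Set.ncard_eq_toFinset_card']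
  exact Set.ncard_image_le (Set.toFinite _)

end Lattice

theorem Connected.card_le_ncard_cells {V : Type*} [Finite V] {G : SignedGraph V}
    (hG : G.Connected) (hb : ¬ G.Balanced) : Nat.card V ≤ G.cells.ncard := by
  cases nonempty_fintype V
  classical
  let _ : LinearOrder V := linearOrderOfSTO WellOrderingRel
  have htop : G.realSpan = ⊤ := realSpan_eq_top_of_forall_realClass_eq_zero fun v => by
    by_contra h
    refine hb (balanced_iff_balancedOn_univ.mpr (G.isLabeling_realClass.balancedOn (r := v) ?_
      fun w _ => SimpleGraph.Connected.preconnected hG v w))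
    rw [← Int.cast_smul_eq_zsmul ℝ]
    exact smul_ne_zero (by norm_num) h
  calc Nat.card V = Module.finrank ℝ G.realSpan := by
        rw [htop, finrank_top, Module.finrank_fintype_fun_eq_card, Nat.card_eq_fintype_card]
    _ ≤ G.cells.ncard := G.finrank_realSpan_le_ncard_cells

end SignedGraph

/-! ### The four kinds of components in terms of balance and cell counts -/

theorem existsUnique_mem_iff_ncard {α : Type*} {S : Set α} : (∃! a, a ∈ S) ↔ S.ncard = 1 := by
  rw [Set.ncard_eq_one]
  simp only [ExistsUnique, Set.eq_singleton_iff_unique_mem]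

namespace SignedGraph

section Classification

variable {V : Type*} {G : SignedGraph V}

theorem IsPseudotree.not_balanced (h : G.IsPseudotree) : ¬ G.Balanced := by
  rintro ⟨⟨ε, hε⟩, -⟩
  obtain ⟨-, ⟨C, hC, hCb, -⟩, -⟩ := h
  exact hCb (hε.isBalancedCycle hC)

theorem component_connected (c : G.underlying.ConnectedComponent) : (G.component c).Connected :=
  c.connected_toSimpleGraph

variable [Finite V]

theorem Connected.not_isCycle (hG : G.Connected) (hcard : G.edges.ncard + 1 = Nat.card V)
    (C : Set (Sym2 V × ℤˣ)) : ¬ G.IsCycle C := by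
  intro hC
  obtain ⟨e, he⟩ := hC.nonempty
  have h1 := (hG.deleteEdge hC he).card_le_ncard_edges_add_one
  have h2 := ncard_edges_deleteEdge (hC.subset_edges he)
  omega

theorem ncard_cells_deleteEdge {e : Sym2 V × ℤˣ} (he : e ∈ G.edges) :
    (G.deleteEdge e).cells.ncard + 1 = G.cells.ncard := by
  have hedges := ncard_edges_deleteEdge he
  have hhalf : (G.deleteEdge e).half = G.half := rfl
  have hloop : (G.deleteEdge e).loop = G.loop := rfl
  rw [ncard_cells, ncard_cells, hhalf, hloop]
  omega

theorem isTree_iff :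
    G.IsTree ↔ G.Connected ∧ G.Balanced ∧ G.cells.ncard + 1 = Nat.card V := by
  constructor
  · rintro ⟨hc, hcyc, hh, hl⟩
    have hcard : G.cells.ncard + 1 = Nat.card V := by
      rw [ncard_cells, hh, hl]
      simpa using hc.ncard_edges_of_forall_not_isCycle hcyc
    refine ⟨hc, ?_, hcard⟩
    by_contra hb
    have := hc.card_le_ncard_cells hb
    omega
  · rintro ⟨hc, ⟨-, hh, hl⟩, hcard⟩
    refine ⟨hc, hc.not_isCycle ?_, hh, hl⟩
    rw [ncard_cells, hh, hl] at hcard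
    simpa using hcard

theorem IsPseudotree.ncard_cells (h : G.IsPseudotree) : G.cells.ncard = Nat.card V := by
  obtain ⟨hc, ⟨C, hC, -, huniq⟩, hh, hl⟩ := h
  obtain ⟨e, he⟩ := hC.nonempty
  have h1 := (hc.deleteEdge hC he).ncard_edges_of_forall_not_isCycle fun C' hC' => by
    rw [isCycle_deleteEdge_iff] at hC'
    exact hC'.2 (huniq C' hC'.1 ▸ he)
  rw [ncard_edges_deleteEdge (hC.subset_edges he)] at h1
  rw [SignedGraph.ncard_cells, hh, hl]
  simpa using h1

theorem Connected.isCycle_subset (hG : G.Connected) (hcard : G.edges.ncard = Nat.card V)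
    {C C' : Set (Sym2 V × ℤˣ)} (hC : G.IsCycle C) (hC' : G.IsCycle C') : C ⊆ C' := by
  intro e he
  by_contra he'
  have hdel := ncard_edges_deleteEdge (hC.subset_edges he)
  exact (hG.deleteEdge hC he).not_isCycle (hdel.trans hcard) C'
    (isCycle_deleteEdge_iff.mpr ⟨hC', he'⟩)

theorem Connected.balanced_of_isBalancedCycle (hG : G.Connected)
    (hcard : G.cells.ncard = Nat.card V) {C : Set (Sym2 V × ℤˣ)} (hC : G.IsCycle C)
    (hCb : IsBalancedCycle C) : G.Balanced := by
  obtain ⟨e, he⟩ := hC.nonempty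
  have hbal : (G.deleteEdge e).Balanced := by
    by_contra hb
    have h1 := (hG.deleteEdge hC he).card_le_ncard_cells hb
    have h2 := ncard_cells_deleteEdge (hC.subset_edges he)
    omega
  obtain ⟨⟨ε, hε⟩, hh, hl⟩ := hbal
  exact ⟨⟨ε, hε.of_deleteEdge hC hCb he⟩, hh, hl⟩

theorem isPseudotree_iff : G.IsPseudotree ↔
    G.Connected ∧ ¬ G.Balanced ∧ G.cells.ncard = Nat.card V ∧ G.half = ∅ ∧ G.loop = ∅ := by
  refine ⟨fun h => ⟨h.1, h.not_balanced, h.ncard_cells, h.2.2⟩, ?_⟩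
  rintro ⟨hc, hb, hcard, hh, hl⟩
  have hedges : G.edges.ncard = Nat.card V := by
    rw [ncard_cells, hh, hl] at hcard
    simpa using hcard
  obtain ⟨C, hC⟩ : ∃ C, G.IsCycle C := by
    by_contra h
    have := hc.ncard_edges_of_forall_not_isCycle fun C hC => h ⟨C, hC⟩
    omega
  exact ⟨hc, ⟨C, hC, fun hCb => hb (hc.balanced_of_isBalancedCycle hcard hC hCb), fun C' hC' =>
    (hc.isCycle_subset hedges hC' hC).antisymm (hc.isCycle_subset hedges hC hC')⟩, hh, hl⟩

theorem isHalfedgeTree_iff : G.IsHalfedgeTree ↔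
    G.Connected ∧ ¬ G.Balanced ∧ G.cells.ncard = Nat.card V ∧ G.half.Nonempty := by
  constructor
  · rintro ⟨hc, hcyc, hh, hl⟩
    have hne : G.half.Nonempty := hh.exists
    refine ⟨hc, fun hb => hne.ne_empty hb.2.1, ?_, hne⟩
    rw [existsUnique_mem_iff_ncard] at hh
    rw [ncard_cells, hh, hl, Set.ncard_empty, ← hc.ncard_edges_of_forall_not_isCycle hcyc]
  · rintro ⟨hc, -, hcard, hne⟩
    have h1 := hc.card_le_ncard_edges_add_one
    have h2 : 0 < G.half.ncard := (Set.ncard_pos (Set.toFinite _)).mpr hne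
    rw [ncard_cells] at hcard
    refine ⟨hc, hc.not_isCycle (by omega), existsUnique_mem_iff_ncard.mpr (by omega), ?_⟩
    rw [← Set.ncard_eq_zero (Set.toFinite _)]
    omega

theorem isLoopTree_iff : G.IsLoopTree ↔
    G.Connected ∧ ¬ G.Balanced ∧ G.cells.ncard = Nat.card V ∧ G.half = ∅ ∧ G.loop.Nonempty := by
  constructor
  · rintro ⟨hc, hcyc, hh, hl⟩
    have hne : G.loop.Nonempty := hl.exists
    refine ⟨hc, fun hb => hne.ne_empty hb.2.2, ?_, hh, hne⟩
    rw [existsUnique_mem_iff_ncard] at hl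
    rw [ncard_cells, hh, hl, Set.ncard_empty, ← hc.ncard_edges_of_forall_not_isCycle hcyc]
  · rintro ⟨hc, -, hcard, hh, hne⟩
    have h1 := hc.card_le_ncard_edges_add_one
    have h2 : 0 < G.loop.ncard := (Set.ncard_pos (Set.toFinite _)).mpr hne
    rw [ncard_cells, hh, Set.ncard_empty] at hcard
    exact ⟨hc, hc.not_isCycle (by omega), hh, existsUnique_mem_iff_ncard.mpr (by omega)⟩

open Classical in
theorem Connected.card_le (hG : G.Connected) :
    Nat.card V ≤ G.cells.ncard + if G.Balanced then 1 else 0 := by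
  split_ifs with h
  · refine hG.card_le_ncard_edges_add_one.trans (Nat.add_le_add_right ?_ 1)
    rw [ncard_cells]
    exact Nat.le_add_right _ _
  · exact hG.card_le_ncard_cells h

open Classical in
theorem Connected.isTree_or_iff (hG : G.Connected) :
    (G.IsTree ∨ G.IsHalfedgeTree ∨ G.IsLoopTree ∨ G.IsPseudotree) ↔
      G.cells.ncard + (if G.Balanced then 1 else 0) = Nat.card V := by
  rw [isTree_iff, isHalfedgeTree_iff, isLoopTree_iff, isPseudotree_iff]
  rcases Set.eq_empty_or_nonempty G.half with hh | hh <;>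
    rcases Set.eq_empty_or_nonempty G.loop with hl | hl <;>
    by_cases hb : G.Balanced <;>
    simp_all [Set.nonempty_iff_ne_empty]

end Classification

end SignedGraph

/-! ### Describing the lattice and the real span by signed sums over the components -/

namespace SignedGraph

variable {V : Type*} {G : SignedGraph V}

section ComponentSign

/-- A chosen vertex of the component `c`. -/
noncomputable def rootOf (c : G.underlying.ConnectedComponent) : V := Quot.out c

@[simp]
theorem connectedComponentMk_rootOf (c : G.underlying.ConnectedComponent) :
    G.underlying.connectedComponentMk (rootOf c) = c := Quot.out_eq c

theorem rootOf_mem_supp (c : G.underlying.ConnectedComponent) : rootOf c ∈ c.supp :=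
  connectedComponentMk_rootOf c

variable {ε : V → ℤˣ} {c : G.underlying.ConnectedComponent} {R : Type*} [CommRing R]

open Classical in
/-- The signs `ε` with values in `R`, cut off outside the component `c`. -/
noncomputable def compSign (R : Type*) [CommRing R] (ε : V → ℤˣ)
    (c : G.underlying.ConnectedComponent) (v : V) : R :=
  if G.underlying.connectedComponentMk v = c then ((ε v : ℤ) : R) else 0

theorem compSign_of_mem {v : V} (hv : v ∈ c.supp) : compSign R ε c v = ((ε v : ℤ) : R) :=
  if_pos hv

theorem compSign_of_notMem {v : V} (hv : v ∉ c.supp) : compSign R ε c v = 0 :=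
  if_neg hv

theorem intCast_compSign (v : V) : ((compSign ℤ ε c v : ℤ) : R) = compSign R ε c v := by
  rw [compSign, compSign]
  split_ifs <;> simp

theorem isLabeling_compSign
    (hedge : ∀ i ∈ c.supp, ∀ j σ, (s(i, j), σ) ∈ G.edges →
      ((ε i : ℤ) : R) = ((σ * ε j : ℤˣ) : ℤ))
    (hhalf : ∀ v ∈ c.supp, v ∉ G.half) (hloop : ∀ v ∈ G.loop, (2 : R) * compSign R ε c v = 0) :
    G.IsLabeling (compSign R ε c) where
  edge i j σ h := by
    rw [compSign, compSign, ← connectedComponentMk_eq_of_mem_edges h]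
    split_ifs with hi
    · rw [hedge i hi j σ h, Units.smul_def, zsmul_eq_mul, Units.val_mul, Int.cast_mul]
    · rw [smul_zero]
  half v hv := compSign_of_notMem fun hc => hhalf v hc hv
  loop v hv := by rw [zsmul_eq_mul, Int.cast_two, hloop v hv]

theorem isLabeling_compSign_of_balancedOn
    (hedge : ∀ i ∈ c.supp, ∀ j σ, (s(i, j), σ) ∈ G.edges → ε i = σ * ε j)
    (h : ∀ v ∈ c.supp, v ∉ G.half ∧ v ∉ G.loop) : G.IsLabeling (compSign R ε c) :=
  isLabeling_compSign (fun i hi j σ hσ => by rw [hedge i hi j σ hσ]) (fun v hv => (h v hv).1)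
    fun v hv => by rw [compSign_of_notMem fun hc => (h v hc).2 hv, mul_zero]

theorem intCast_units_zmod_two (u : ℤˣ) : ((u : ℤ) : ZMod 2) = 1 := by
  rcases Int.units_eq_one_or u with rfl | rfl <;> rfl

theorem isLabeling_compSign_zmod_two (h : (G.component c).half = ∅) :
    G.IsLabeling (compSign (ZMod 2) ε c) :=
  isLabeling_compSign (fun i _ j σ _ => by rw [intCast_units_zmod_two, intCast_units_zmod_two])
    (half_component_eq_empty_iff.mp h)
    fun v _ => by rw [show (2 : ZMod 2) = 0 from rfl, zero_mul]

variable [Fintype V]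

/-- The sum over the component `c` of the coordinates of a vector, with signs `ε`. -/
noncomputable def signedSum (R : Type*) [CommRing R] (ε : V → ℤˣ)
    (c : G.underlying.ConnectedComponent) : (V → R) →ₗ[R] R :=
  Fintype.linearCombination R (compSign R ε c)

theorem signedSum_intCast (x : V → ℤ) :
    signedSum R ε c (fun v => (x v : R)) = (signedSum ℤ ε c x : ℤ) := by
  simp [signedSum, Fintype.linearCombination_apply, intCast_compSign]

theorem even_signedSum_iff (x : V → ℤ) :
    Even (signedSum ℤ ε c x) ↔ signedSum (ZMod 2) ε c (fun v => (x v : ZMod 2)) = 0 := by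
  rw [signedSum_intCast, ZMod.intCast_eq_zero_iff_even]

theorem even_signedSum_one_iff : Even (signedSum ℤ ε c 1) ↔ Even c.supp.ncard := by
  classical
  have hsupp : c.supp =
      (Finset.univ.filter fun v => G.underlying.connectedComponentMk v = c : Finset V) := by
    ext v
    simp
  rw [even_signedSum_iff, ← ZMod.natCast_eq_zero_iff_even, hsupp, Set.ncard_coe_finset]
  simp [signedSum, Fintype.linearCombination_apply, compSign, intCast_units_zmod_two]

theorem exists_forall_signedSum_eq (ε : V → ℤˣ) (z : G.underlying.ConnectedComponent → R) :
    ∃ y : V → R, ∀ c, signedSum R ε c y = z c := by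
  classical
  refine ⟨fun v => if v = rootOf (G.underlying.connectedComponentMk v) then
    ((ε v : ℤ) : R) * z (G.underlying.connectedComponentMk v) else 0, fun c => ?_⟩
  rw [signedSum, Fintype.linearCombination_apply, Finset.sum_eq_single (rootOf c)]
  · rw [connectedComponentMk_rootOf, if_pos rfl, compSign_of_mem (rootOf_mem_supp c), smul_eq_mul,
      mul_right_comm, ← Int.cast_mul, ← Units.val_mul, Int.units_mul_self]
    simp
  · intro v _ hv
    by_cases hc : v ∈ c.supp
    · have hmk : G.underlying.connectedComponentMk v = c := hc
      simp only [hmk, if_neg hv, zero_smul]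
    · rw [compSign_of_notMem hc, smul_zero]
  · simp

end ComponentSign

section Signing

variable [LinearOrder V]

/-- The signs `ε` express the class of every standard basis vector modulo the lattice of `G`
through the class of the basis vector of the chosen vertex of its component. -/
def IsSigning (G : SignedGraph V) (ε : V → ℤˣ) : Prop :=
  ∀ v, G.latticeClass v =
    ε v • G.latticeClass (rootOf (G.underlying.connectedComponentMk v))

theorem exists_isSigning (G : SignedGraph V) : ∃ ε, G.IsSigning ε :=
  Classical.skolem.mp fun _ => G.isLabeling_latticeClass.exists_eq_smul
    (SimpleGraph.ConnectedComponent.exact (connectedComponentMk_rootOf _))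

variable {ε : V → ℤˣ} {c : G.underlying.ConnectedComponent}

theorem IsLabeling.exists_map_latticeClass_eq [Finite V] {M : Type*} [AddCommGroup M] {f : V → M}
    (hf : G.IsLabeling f) :
    ∃ φ : (V → ℤ) ⧸ G.lattice →+ M, ∀ v, φ (G.latticeClass v) = f v := by
  cases nonempty_fintype V
  refine ⟨QuotientAddGroup.lift G.lattice (Fintype.linearCombination ℤ f).toAddMonoidHom
    fun x hx => hf.linearCombination_intCast_eq_zero hx, fun v => ?_⟩
  exact (linearCombination_single_intCast v 1).trans (one_smul ℤ (f v))

theorem IsSigning.eq_smul [Finite V] (hε : G.IsSigning ε) {M : Type*} [AddCommGroup M] {f : V → M}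
    (hf : G.IsLabeling f) (v : V) :
    f v = ε v • f (rootOf (G.underlying.connectedComponentMk v)) := by
  obtain ⟨φ, hφ⟩ := hf.exists_map_latticeClass_eq
  rw [← hφ, ← hφ, hε v, Units.smul_def, map_zsmul, ← Units.smul_def]

theorem two_smul_latticeClass_rootOf_ne_zero [Finite V] (hc : (G.component c).Balanced) :
    (2 : ℤ) • G.latticeClass (rootOf c) ≠ 0 := by
  obtain ⟨⟨ε, hε⟩, hn⟩ := component_balanced_iff.mp hc
  obtain ⟨φ, hφ⟩ :=
    (isLabeling_compSign_of_balancedOn (R := ℤ) hε hn).exists_map_latticeClass_eq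
  intro h
  have h' := congrArg φ h
  rw [map_zsmul, hφ, map_zero, compSign_of_mem (rootOf_mem_supp c)] at h'
  simp at h'

theorem IsSigning.isLabeling_compSign [Finite V] (hε : G.IsSigning ε)
    (hc : (G.component c).Balanced) (R : Type*) [CommRing R] : G.IsLabeling (compSign R ε c) := by
  refine isLabeling_compSign_of_balancedOn (fun i hi j σ h => ?_) (component_balanced_iff.mp hc).2
  have hij := connectedComponentMk_eq_of_mem_edges h
  obtain rfl : G.underlying.connectedComponentMk i = c := hi
  refine G.isLabeling_latticeClass.switches (two_smul_latticeClass_rootOf_ne_zero hc) (hε i) ?_ h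
  rw [hij]
  exact hε j

variable [Fintype V]

open Classical in
theorem IsSigning.linearCombination_eq_sum (hε : G.IsSigning ε) {R M : Type*} [CommRing R]
    [AddCommGroup M] [Module R M] {f : V → M} (hf : G.IsLabeling f) (y : V → R) :
    Fintype.linearCombination R f y =
      ∑ c : G.underlying.ConnectedComponent, signedSum R ε c y • f (rootOf c) := by
  have hfv : ∀ v, f v =
      ∑ c : G.underlying.ConnectedComponent, compSign R ε c v • f (rootOf c) := fun v => by
    rw [Finset.sum_eq_single (G.underlying.connectedComponentMk v)]
    · rw [compSign_of_mem rfl, Int.cast_smul_eq_zsmul, ← Units.smul_def]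
      exact hε.eq_smul hf v
    · exact fun c _ hc => by rw [compSign_of_notMem fun h => hc h.symm, zero_smul]
    · simp
  calc ∑ v, y v • f v
      = ∑ v, ∑ c : G.underlying.ConnectedComponent, (y v * compSign R ε c v) • f (rootOf c) := by
        simp only [mul_smul, ← Finset.smul_sum, ← hfv]
    _ = ∑ c : G.underlying.ConnectedComponent, signedSum R ε c y • f (rootOf c) := by
        rw [Finset.sum_comm]
        simp only [← Finset.sum_smul]
        rfl

theorem IsSigning.signedSum_smul_latticeClass (hε : G.IsSigning ε) {x : V → ℤ}
    (hbal : (G.component c).Balanced → signedSum ℤ ε c x = 0)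
    (hunbal : ¬ (G.component c).Balanced → (G.component c).half = ∅ → Even (signedSum ℤ ε c x)) :
    signedSum ℤ ε c x • G.latticeClass (rootOf c) = 0 := by
  by_cases hb : (G.component c).Balanced
  · rw [hbal hb, zero_smul]
  rcases Set.eq_empty_or_nonempty (G.component c).half with hh | ⟨⟨v, hv⟩, hvh⟩
  · obtain ⟨k, hk⟩ := hunbal hb hh
    rw [hk, ← mul_two, mul_smul,
      G.isLabeling_latticeClass.two_smul_eq_zero_of_not_balanced hb (rootOf_mem_supp c), smul_zero]
  · obtain rfl : G.underlying.connectedComponentMk v = c := hv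
    have h := hε v
    rw [G.isLabeling_latticeClass.half v hvh] at h
    rw [← inv_smul_smul (ε v) (G.latticeClass _), ← h, smul_zero, smul_zero]

theorem IsSigning.mem_lattice_iff (hε : G.IsSigning ε) {x : V → ℤ} :
    x ∈ G.lattice ↔
      (∀ c, (G.component c).Balanced → signedSum ℤ ε c x = 0) ∧
      ∀ c, ¬ (G.component c).Balanced → (G.component c).half = ∅ →
        Even (signedSum ℤ ε c x) := by
  classical
  refine ⟨fun hx => ⟨fun c hc => ?_, fun c _ hh => ?_⟩, fun ⟨hbal, hunbal⟩ => ?_⟩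
  · exact (hε.isLabeling_compSign hc ℤ).linearCombination_intCast_eq_zero (R := ℤ) hx
  · rw [even_signedSum_iff]
    exact (isLabeling_compSign_zmod_two hh).linearCombination_intCast_eq_zero hx
  · rw [← QuotientAddGroup.eq_zero_iff, mk_eq_linearCombination_latticeClass,
      hε.linearCombination_eq_sum G.isLabeling_latticeClass]
    exact Finset.sum_eq_zero fun c _ => hε.signedSum_smul_latticeClass (hbal c) (hunbal c)

theorem IsSigning.mem_realSpan_iff (hε : G.IsSigning ε) {y : V → ℝ} :
    y ∈ G.realSpan ↔ ∀ c, (G.component c).Balanced → signedSum ℝ ε c y = 0 := by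
  classical
  refine ⟨fun hy c hc => (hε.isLabeling_compSign hc ℝ).linearCombination_eq_zero_of_mem_realSpan hy,
    fun h => ?_⟩
  rw [← Submodule.ker_mkQ G.realSpan, LinearMap.mem_ker, mkQ_eq_linearCombination_realClass,
    hε.linearCombination_eq_sum G.isLabeling_realClass]
  refine Finset.sum_eq_zero fun c _ => ?_
  by_cases hb : (G.component c).Balanced
  · rw [h c hb, zero_smul]
  · rw [realClass_eq_zero_of_not_balanced hb (rootOf_mem_supp c), smul_zero]

end Signing

end SignedGraph

namespace SignedGraph

section Index

variable {V : Type*} [Fintype V] {G : SignedGraph V} {ε : V → ℤˣ}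

open Classical in
/-- The parities of the signed sums over the components that are neither balanced nor carry a
halfedge. -/
noncomputable def signedParity (G : SignedGraph V) (ε : V → ℤˣ) :
    (V → ℤ) →+ ({c | ¬ (G.component c).Balanced ∧ (G.component c).half = ∅} → ZMod 2) :=
  AddMonoidHom.pi fun c => (Int.castAddHom (ZMod 2)).comp (signedSum ℤ ε c.1).toAddMonoidHom

theorem signedParity_apply (x : V → ℤ)
    (c : {c | ¬ (G.component c).Balanced ∧ (G.component c).half = ∅}) :
    G.signedParity ε x c = ((signedSum ℤ ε c.1 x : ℤ) : ZMod 2) := rfl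

theorem signedSum_latticeCast_sub_eq_zero_iff {w : V → ℝ} {k : V → ℤ}
    (hw : ∀ v, w v = k v + 1 / 2) (c : G.underlying.ConnectedComponent) (x : V → ℤ) :
    signedSum ℝ ε c (latticeCast V x - w) = 0 ↔
      signedSum ℤ ε c 1 = 2 * signedSum ℤ ε c (x - k) := by
  have hsplit : latticeCast V x - w =
      latticeCast V (x - k) - (1 / 2 : ℝ) • latticeCast V 1 := by
    ext v
    simp [hw, sub_sub]
  have hcast : ∀ y : V → ℤ, signedSum ℝ ε c (latticeCast V y) = (signedSum ℤ ε c y : ℝ) :=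
    fun y => signedSum_intCast y
  rw [hsplit, map_sub, map_smul, hcast, hcast, ← Int.cast_inj (α := ℝ), smul_eq_mul,
    Int.cast_mul, Int.cast_two]
  constructor <;> intro h <;> linarith

variable [LinearOrder V]

theorem IsSigning.latticeCast_mem_realSpan_iff (hε : G.IsSigning ε) {x : V → ℤ} :
    latticeCast V x ∈ G.realSpan ↔
      ∀ c, (G.component c).Balanced → signedSum ℤ ε c x = 0 := by
  rw [hε.mem_realSpan_iff]
  refine forall₂_congr fun c _ => ?_
  rw [← Int.cast_eq_zero (α := ℝ), ← signedSum_intCast]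
  rfl

theorem IsSigning.lattice_eq (hε : G.IsSigning ε) :
    G.lattice =
      (G.signedParity ε).ker ⊓ G.realSpan.toAddSubgroup.comap (latticeCast V) := by
  ext x
  rw [hε.mem_lattice_iff, AddSubgroup.mem_inf, AddMonoidHom.mem_ker, funext_iff, and_comm]
  refine and_congr ?_ hε.latticeCast_mem_realSpan_iff.symm
  simp only [Subtype.forall, signedParity_apply, Set.mem_ofPred_eq, and_imp, Pi.zero_apply,
    ZMod.intCast_eq_zero_iff_even]

theorem IsSigning.map_signedParity (hε : G.IsSigning ε) :
    (G.realSpan.toAddSubgroup.comap (latticeCast V)).map (G.signedParity ε) = ⊤ := by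
  classical
  rw [eq_top_iff]
  rintro z -
  obtain ⟨y, hy⟩ := exists_forall_signedSum_eq (G := G) (R := ℤ) ε fun c =>
    if hc : ¬ (G.component c).Balanced ∧ (G.component c).half = ∅ then (z ⟨c, hc⟩).cast else 0
  refine ⟨y, hε.latticeCast_mem_realSpan_iff.mpr fun c hc => ?_, funext fun c => ?_⟩
  · rw [hy, dif_neg fun h => h.1 hc]
  · have hc : ¬ (G.component c.1).Balanced ∧ (G.component c.1).half = ∅ := c.2
    rw [signedParity_apply, hy, dif_pos hc, ZMod.intCast_zmod_cast]

end Index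

section Index

variable {V : Type*} [Finite V] [LinearOrder V] {G : SignedGraph V}

theorem relIndex_lattice (G : SignedGraph V) :
    G.lattice.relIndex (G.realSpan.toAddSubgroup.comap (latticeCast V)) =
      2 ^ {c | ¬ (G.component c).Balanced ∧ (G.component c).half = ∅}.ncard := by
  cases nonempty_fintype V
  obtain ⟨ε, hε⟩ := G.exists_isSigning
  rw [hε.lattice_eq, AddSubgroup.inf_relIndex_right, AddSubgroup.relIndex_ker,
    hε.map_signedParity, AddSubgroup.card_top, Nat.card_fun, Nat.card_zmod, Nat.card_coe_set_eq]

theorem finrank_realSpan_add_ncard_balanced (G : SignedGraph V) :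
    Module.finrank ℝ G.realSpan + {c | (G.component c).Balanced}.ncard = Nat.card V := by
  classical
  cases nonempty_fintype V
  obtain ⟨ε, hε⟩ := G.exists_isSigning
  let Ψ : (V → ℝ) →ₗ[ℝ] ({c | (G.component c).Balanced} → ℝ) :=
    LinearMap.pi fun c => signedSum ℝ ε c.1
  have hker : Ψ.ker = G.realSpan := by
    ext y
    rw [hε.mem_realSpan_iff, LinearMap.mem_ker, funext_iff]
    exact Subtype.forall
  have hsurj : Function.Surjective Ψ := fun z => by
    obtain ⟨y, hy⟩ := exists_forall_signedSum_eq (G := G) ε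
      fun c => if hc : (G.component c).Balanced then z ⟨c, hc⟩ else 0
    exact ⟨y, funext fun c => (hy c).trans (dif_pos c.2)⟩
  have := Fintype.ofFinite {c | (G.component c).Balanced}
  have h := Ψ.finrank_range_add_finrank_ker
  rwa [hker, LinearMap.range_eq_top.mpr hsurj, finrank_top, Module.finrank_fintype_fun_eq_card,
    Module.finrank_fintype_fun_eq_card, ← Nat.card_eq_fintype_card, ← Nat.card_eq_fintype_card,
    Nat.card_coe_set_eq, add_comm] at h

theorem exists_latticeCast_sub_mem_realSpan_iff {w : V → ℝ} {k : V → ℤ}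
    (hw : ∀ v, w v = k v + 1 / 2) :
    (∃ x, latticeCast V x - w ∈ G.realSpan) ↔
      ∀ c, (G.component c).Balanced → Even c.supp.ncard := by
  classical
  cases nonempty_fintype V
  obtain ⟨ε, hε⟩ := G.exists_isSigning
  simp only [hε.mem_realSpan_iff, signedSum_latticeCast_sub_eq_zero_iff hw,
    ← even_signedSum_one_iff (ε := ε)]
  refine ⟨fun ⟨x, hx⟩ c hc => hx c hc ▸ even_two_mul _, fun h => ?_⟩
  obtain ⟨y, hy⟩ := exists_forall_signedSum_eq (G := G) ε fun c => signedSum ℤ ε c 1 / 2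
  refine ⟨k + y, fun c hc => ?_⟩
  rw [add_sub_cancel_left, hy, Int.two_mul_ediv_two_of_even (h c hc)]

end Index

end SignedGraph

theorem ncard_eq_sum_ncard_fiber {α β : Type*} [Finite α] [Fintype β] (f : α → β) (S : Set α) :
    S.ncard = ∑ b, {a ∈ S | f a = b}.ncard := by
  classical
  have := Fintype.ofFinite α
  rw [Set.ncard_eq_toFinset_card', Finset.card_eq_sum_card_fiberwise (f := f) (t := Finset.univ)
    fun _ _ => Finset.mem_coe.mpr (Finset.mem_univ _)]
  refine Finset.sum_congr rfl fun b _ => ?_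
  rw [Set.ncard_eq_toFinset_card']
  congr 1
  ext a
  simp

namespace SignedGraph

section CellComponent

variable {V : Type*}

/-- The cells of an induced signed graph, viewed as cells on the full vertex set. -/
def cellInclusion (S : Set V) : Cell S → Cell V :=
  Sum.map (Prod.map (Sym2.map Subtype.val) id) (Sum.map Subtype.val Subtype.val)

theorem cellInclusion_injective (S : Set V) : Function.Injective (cellInclusion S) :=
  Sum.map_injective.mpr ⟨(Sym2.map.injective Subtype.val_injective).prodMap Function.injective_id,
    Sum.map_injective.mpr ⟨Subtype.val_injective, Subtype.val_injective⟩⟩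

theorem cellInclusion_mem_cells_iff {G : SignedGraph V} {c : G.underlying.ConnectedComponent}
    {e : Cell c.supp} : cellInclusion c.supp e ∈ G.cells ↔ e ∈ (G.component c).cells := by
  rcases e with ⟨p, σ⟩ | v | v
  · induction p using Sym2.ind with
    | _ i j => exact mem_edges_component_iff.symm
  · exact Iff.rfl
  · exact Iff.rfl

variable [LinearOrder V]

/-- The component of `G` containing the cell, read off for an edge at its smaller end. -/
def cellComponent (G : SignedGraph V) : Cell V → G.underlying.ConnectedComponent
  | .inl (p, _) => G.underlying.connectedComponentMk p.inf
  | .inr (.inl v) => G.underlying.connectedComponentMk v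
  | .inr (.inr v) => G.underlying.connectedComponentMk v

theorem cellComponent_mk {G : SignedGraph V} {i j : V} {σ : ℤˣ} (h : (s(i, j), σ) ∈ G.edges) :
    G.cellComponent (.inl (s(i, j), σ)) = G.underlying.connectedComponentMk i := by
  rcases le_total i j with hij | hij
  · simp [cellComponent, hij]
  · simp [cellComponent, hij, connectedComponentMk_eq_of_mem_edges h]

theorem image_cellInclusion_cells {G : SignedGraph V} (c : G.underlying.ConnectedComponent) :
    cellInclusion c.supp '' (G.component c).cells = {e ∈ G.cells | G.cellComponent e = c} := by
  ext e
  constructor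
  · rintro ⟨e, he, rfl⟩
    have he' := cellInclusion_mem_cells_iff.mpr he
    refine ⟨he', ?_⟩
    rcases e with ⟨p, σ⟩ | v | v
    · induction p using Sym2.ind with
      | _ i j => exact (cellComponent_mk he').trans i.2
    · exact v.2
    · exact v.2
  · rintro ⟨he, hc⟩
    suffices ∃ e', cellInclusion c.supp e' = e by
      obtain ⟨e', rfl⟩ := this
      exact ⟨e', cellInclusion_mem_cells_iff.mp he, rfl⟩
    rcases e with ⟨p, σ⟩ | v | v
    · induction p using Sym2.ind with
      | _ i j =>
        have hi : i ∈ c.supp := (cellComponent_mk he).symm.trans hc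
        have hj : j ∈ c.supp := (connectedComponentMk_eq_of_mem_edges he).symm.trans hi
        exact ⟨.inl (s(⟨i, hi⟩, ⟨j, hj⟩), σ), rfl⟩
    · exact ⟨.inr (.inl ⟨v, hc⟩), rfl⟩
    · exact ⟨.inr (.inr ⟨v, hc⟩), rfl⟩

theorem ncard_cells_eq_sum [Finite V] (G : SignedGraph V)
    [Fintype G.underlying.ConnectedComponent] :
    G.cells.ncard = ∑ c, (G.component c).cells.ncard := by
  rw [ncard_eq_sum_ncard_fiber G.cellComponent]
  refine Finset.sum_congr rfl fun c _ => ?_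
  rw [← image_cellInclusion_cells, Set.ncard_image_of_injective _ (cellInclusion_injective _)]

end CellComponent

theorem card_eq_sum_card_supp {V : Type*} [Finite V] (G : SignedGraph V)
    [Fintype G.underlying.ConnectedComponent] :
    Nat.card V = ∑ c : G.underlying.ConnectedComponent, Nat.card c.supp := by
  rw [← Set.ncard_univ, ncard_eq_sum_ncard_fiber G.underlying.connectedComponentMk]
  refine Finset.sum_congr rfl fun c _ => ?_
  rw [Nat.card_coe_set_eq]
  congr 1
  ext v
  simp

section Pseudoforest

variable {V : Type*} [Finite V] {G : SignedGraph V}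

theorem IsPseudoforest.component_isTree_iff (hG : G.IsPseudoforest)
    (c : G.underlying.ConnectedComponent) :
    (G.component c).IsTree ↔ (G.component c).Balanced := by
  refine ⟨fun h => (isTree_iff.mp h).2.1, fun hb => ?_⟩
  rcases hG c with h | h | h | h
  · exact h
  · exact absurd hb (isHalfedgeTree_iff.mp h).2.1
  · exact absurd hb (isLoopTree_iff.mp h).2.1
  · exact absurd hb (isPseudotree_iff.mp h).2.1

theorem IsPseudoforest.pc_add_lc (hG : G.IsPseudoforest) :
    G.pc + G.lc = {c | ¬ (G.component c).Balanced ∧ (G.component c).half = ∅}.ncard := by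
  have hdisj : Disjoint {c | (G.component c).IsPseudotree} {c | (G.component c).IsLoopTree} :=
    Set.disjoint_left.mpr fun c hp hl =>
      (isLoopTree_iff.mp hl).2.2.2.2.ne_empty (isPseudotree_iff.mp hp).2.2.2.2
  rw [pc, lc, ← Set.ncard_union_eq hdisj]
  congr 1
  ext c
  constructor
  · rintro (h | h)
    · have h' := isPseudotree_iff.mp h
      exact ⟨h'.2.1, h'.2.2.2.1⟩
    · have h' := isLoopTree_iff.mp h
      exact ⟨h'.2.1, h'.2.2.2.1⟩
  · rintro ⟨hb, hh⟩
    rcases hG c with h | h | h | h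
    · exact absurd (isTree_iff.mp h).2.1 hb
    · exact absurd hh (isHalfedgeTree_iff.mp h).2.2.2.ne_empty
    · exact Or.inr h
    · exact Or.inl h

theorem lc_eq_zero (h : G.loop = ∅) : G.lc = 0 := by
  rw [lc, Set.ncard_eq_zero (Set.toFinite _), Set.eq_empty_iff_forall_notMem]
  rintro c ⟨-, -, -, v, hv, -⟩
  exact h.subset hv

variable [LinearOrder V]

theorem linearIndepOn_cells_iff_ncard :
    LinearIndepOn ℝ (latticeCast V ∘ cellVec) G.cells ↔
      G.cells.ncard = Module.finrank ℝ G.realSpan := by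
  have : Fintype G.cells := Fintype.ofFinite _
  rw [LinearIndepOn, linearIndependent_iff_card_eq_finrank_span, Set.finrank,
    ← Nat.card_eq_fintype_card, Nat.card_coe_set_eq, realSpan, Set.image_eq_range]

-- Both sides of the cardinality criterion are sums over the components, and on each component
-- the rank is bounded by the number of cells.
theorem linearIndepOn_cells_iff :
    LinearIndepOn ℝ (latticeCast V ∘ cellVec) G.cells ↔ G.IsPseudoforest := by
  classical
  have : Fintype G.underlying.ConnectedComponent := Fintype.ofFinite _
  have hrank := G.finrank_realSpan_add_ncard_balanced
  have hbal : {c | (G.component c).Balanced}.ncard =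
      ∑ c, if (G.component c).Balanced then 1 else 0 := by
    rw [Finset.sum_boole, Set.ncard_eq_toFinset_card', Set.toFinset_ofPred, Nat.cast_id]
  have hsum : G.cells.ncard = Module.finrank ℝ G.realSpan ↔
      ∑ c : G.underlying.ConnectedComponent, Nat.card c.supp =
        ∑ c, ((G.component c).cells.ncard + if (G.component c).Balanced then 1 else 0) := by
    rw [Finset.sum_add_distrib, ← hbal, ← ncard_cells_eq_sum, ← card_eq_sum_card_supp]
    omega
  rw [linearIndepOn_cells_iff_ncard, hsum,
    Finset.sum_eq_sum_iff_of_le fun c _ => (component_connected c).card_le]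
  exact ⟨fun h c => (component_connected c).isTree_or_iff.mpr (h c (Finset.mem_univ c)).symm,
    fun h c _ => ((component_connected c).isTree_or_iff.mp (h c)).symm⟩

theorem IsPseudoforest.ncard_cells (hG : G.IsPseudoforest) :
    G.cells.ncard = Nat.card V - G.tc := by
  have hcard := linearIndepOn_cells_iff_ncard.mp (linearIndepOn_cells_iff.mpr hG)
  have hrank := G.finrank_realSpan_add_ncard_balanced
  simp only [tc, hG.component_isTree_iff]
  omega

end Pseudoforest

section Count

variable {V : Type*} [LinearOrder V] {G : SignedGraph V} {t : ℕ}

theorem span_nsmul_cells (ht : t ≠ 0) :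
    Submodule.span ℝ ((latticeCast V ∘ fun e => t • cellVec e) '' G.cells) = G.realSpan := by
  have ht' : IsUnit (t : ℝ) := (Nat.cast_ne_zero.mpr ht).isUnit
  have himage : (latticeCast V ∘ fun e => t • cellVec e) '' G.cells =
      (t : ℝ) • ((latticeCast V ∘ cellVec) '' G.cells) := by
    rw [← Set.image_smul, Set.image_image]
    simp only [Function.comp_apply, map_nsmul, Nat.cast_smul_eq_nsmul]
  rw [himage, Submodule.span_smul_eq_of_isUnit _ _ ht', realSpan]

variable [Finite V]

theorem IsPseudoforest.relIndex_closure_nsmul_cells (hG : G.IsPseudoforest) (t : ℕ) :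
    (AddSubgroup.closure ((fun e => t • cellVec e) '' G.cells)).relIndex
      (G.realSpan.toAddSubgroup.comap (latticeCast V)) =
    2 ^ (G.pc + G.lc) * t ^ (Nat.card V - G.tc) := by
  have hfin : G.cells.Finite := Set.toFinite _
  have hindep : LinearIndepOn ℤ (cellVec : Cell V → V → ℤ) G.cells :=
    LinearIndependent.of_comp (latticeCast V).toIntLinearMap
      ((linearIndepOn_cells_iff.mpr hG).restrict_scalars' ℤ)
  have hindex : (AddSubgroup.closure ((fun e => t • cellVec e) '' G.cells)).relIndex G.lattice =
      t ^ (Nat.card V - G.tc) := by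
    have h := relIndex_closure_nsmul cellVec hfin.toFinset (by rwa [hfin.coe_toFinset]) t
    rwa [hfin.coe_toFinset, ← Set.ncard_eq_toFinset_card _ hfin, hG.ncard_cells] at h
  have hle : AddSubgroup.closure ((fun e => t • cellVec e) '' G.cells) ≤ G.lattice := by
    rw [AddSubgroup.closure_le]
    rintro _ ⟨e, he, rfl⟩
    exact G.lattice.nsmul_mem (AddSubgroup.subset_closure ⟨e, he, rfl⟩) t
  rw [← AddSubgroup.relIndex_mul_relIndex _ _ _ hle fun x hx => latticeCast_mem_realSpan hx,
    hindex, relIndex_lattice, ← hG.pc_add_lc, mul_comm]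

open Classical in
theorem IsPseudoforest.residueCount_eq (hG : G.IsPseudoforest) (ht : t ≠ 0) (w : V → ℝ) :
    residueCount (AddSubgroup.closure ((fun e => t • cellVec e) '' G.cells))
      (latticeCast V ⁻¹' ({w} + (G.realSpan : Set (V → ℝ)))) =
    ((if ∃ x, latticeCast V x - w ∈ G.realSpan then
      2 ^ (G.pc + G.lc) * t ^ (Nat.card V - G.tc) else 0 : ℕ) : ℕ∞) := by
  have hindex := hG.relIndex_closure_nsmul_cells t
  split_ifs with h
  · obtain ⟨x, hx⟩ := h
    rw [← hindex]
    refine residueCount_preimage_singleton_add hx ?_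
    rw [hindex]
    positivity
  · have hempty : latticeCast V ⁻¹' ({w} + (G.realSpan : Set (V → ℝ))) = ∅ :=
      Set.eq_empty_iff_forall_notMem.mpr fun x hx => h ⟨x, mem_singleton_add_submodule_iff.mp hx⟩
    rw [hempty, residueCount_empty, Nat.cast_zero]

end Count

end SignedGraph

/-! ### Signed graphs as sets of positive roots -/

section SortedPairs

variable {α : Type*} [LinearOrder α]

theorem sym2_mk_inf_sup (p : Sym2 α) : s(p.inf, p.sup) = p :=
  Sym2.sortEquiv.symm_apply_apply p

theorem sym2_inf_lt_sup {p : Sym2 α} (hp : ¬ p.IsDiag) : p.inf < p.sup := by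
  refine p.inf_le_sup.lt_of_ne fun h => hp ?_
  rw [← sym2_mk_inf_sup p]
  exact h

theorem sym2_mem_iff {p : Sym2 α} {a : α} : a ∈ p ↔ a = p.inf ∨ a = p.sup := by
  rw [← Sym2.mem_iff, sym2_mk_inf_sup]

theorem exists_not_isDiag_iff {Q : Sym2 α → Prop} :
    (∃ p, ¬ p.IsDiag ∧ Q p) ↔ ∃ i j, i < j ∧ Q s(i, j) :=
  ⟨fun ⟨p, hp, h⟩ => ⟨p.inf, p.sup, sym2_inf_lt_sup hp, (sym2_mk_inf_sup p).symm ▸ h⟩,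
    fun ⟨i, j, hij, h⟩ => ⟨s(i, j), hij.ne, h⟩⟩

end SortedPairs

theorem single_inj_of_ne_zero {ι M : Type*} [DecidableEq ι] [Zero M] {i j : ι} {a b : M}
    (ha : a ≠ 0) (h : (Pi.single i a : ι → M) = Pi.single j b) : i = j ∧ a = b := by
  have hi := congrFun h i
  rw [Pi.single_eq_same, Pi.single_apply] at hi
  split_ifs at hi with hij
  · exact ⟨hij, hi⟩
  · exact absurd hi ha

namespace SignedGraph

section FullGraph

variable {V : Type*} {G H : SignedGraph V}

/-- The largest signed graph of type `Φ` on `V`; its cells encode all the positive roots. -/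
def fullGraph (V : Type*) (Φ : ClassicalType) : SignedGraph V where
  pos := ⊤
  neg := match Φ with
    | .A => ⊥
    | _ => ⊤
  half := match Φ with
    | .B => Set.univ
    | _ => ∅
  loop := match Φ with
    | .C => Set.univ
    | _ => ∅

theorem exists_mem_cells_iff {Q : Cell V → Prop} :
    (∃ e ∈ G.cells, Q e) ↔
      (∃ p ∈ G.pos.edgeSet, Q (.inl (p, 1))) ∨ (∃ p ∈ G.neg.edgeSet, Q (.inl (p, -1))) ∨
        (∃ v ∈ G.half, Q (.inr (.inl v))) ∨ ∃ v ∈ G.loop, Q (.inr (.inr v)) := by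
  constructor
  · rintro ⟨⟨p, σ⟩ | v | v, he, h⟩
    · rcases he with ⟨hp, rfl : σ = 1⟩ | ⟨hp, rfl : σ = -1⟩
      · exact Or.inl ⟨p, hp, h⟩
      · exact Or.inr (Or.inl ⟨p, hp, h⟩)
    · exact Or.inr (Or.inr (Or.inl ⟨v, he, h⟩))
    · exact Or.inr (Or.inr (Or.inr ⟨v, he, h⟩))
  · rintro (⟨p, hp, h⟩ | ⟨p, hp, h⟩ | ⟨v, hv, h⟩ | ⟨v, hv, h⟩)
    · exact ⟨_, Or.inl ⟨hp, rfl⟩, h⟩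
    · exact ⟨_, Or.inr ⟨hp, rfl⟩, h⟩
    · exact ⟨_, hv, h⟩
    · exact ⟨_, hv, h⟩

theorem cells_subset_iff :
    G.cells ⊆ H.cells ↔ G.pos ≤ H.pos ∧ G.neg ≤ H.neg ∧ G.half ⊆ H.half ∧ G.loop ⊆ H.loop := by
  constructor
  · intro h
    refine ⟨fun i j hij => ?_, fun i j hij => ?_, fun v hv => ?_, fun v hv => ?_⟩
    · have h' : (s(i, j), 1) ∈ H.edges := h (a := .inl (s(i, j), 1)) (Or.inl ⟨hij, rfl⟩)
      simpa [mem_edges_iff] using h'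
    · have h' : (s(i, j), -1) ∈ H.edges := h (a := .inl (s(i, j), -1)) (Or.inr ⟨hij, rfl⟩)
      simpa [mem_edges_iff] using h'
    · exact h (a := .inr (.inl v)) hv
    · exact h (a := .inr (.inr v)) hv
  · rintro ⟨hpos, hneg, hhalf, hloop⟩ (⟨p, σ⟩ | v | v) he
    · exact Or.imp (And.imp_left fun h => SimpleGraph.edgeSet_mono hpos h)
        (And.imp_left fun h => SimpleGraph.edgeSet_mono hneg h) he
    · exact hhalf he
    · exact hloop he

theorem isGraphOfType_iff {Φ : ClassicalType} :
    G.IsGraphOfType Φ ↔ G.cells ⊆ (fullGraph V Φ).cells := by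
  rw [cells_subset_iff]
  cases Φ <;> simp [IsGraphOfType, fullGraph]

theorem cells_injective : Function.Injective (cells : SignedGraph V → Set (Cell V)) := by
  intro G H h
  have hGH := cells_subset_iff.mp h.subset
  have hHG := cells_subset_iff.mp h.superset
  exact SignedGraph.ext (hGH.1.antisymm hHG.1) (hGH.2.1.antisymm hHG.2.1)
    (hGH.2.2.1.antisymm hHG.2.2.1) (hGH.2.2.2.antisymm hHG.2.2.2)

theorem not_isDiag_of_mem_cells {p : Sym2 V} {σ : ℤˣ} (h : .inl (p, σ) ∈ G.cells) :
    ¬ p.IsDiag := by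
  induction p using Sym2.ind with
  | _ i j => exact ne_of_mem_edges h

theorem exists_cells_eq {S : Set (Cell V)} (hS : S ⊆ H.cells) :
    ∃ G : SignedGraph V, G.cells = S := by
  refine ⟨⟨.fromEdgeSet {p | .inl (p, 1) ∈ S}, .fromEdgeSet {p | .inl (p, -1) ∈ S},
    {v | .inr (.inl v) ∈ S}, {v | .inr (.inr v) ∈ S}⟩, ?_⟩
  ext (⟨p, σ⟩ | v | v)
  · change ((p ∈ SimpleGraph.edgeSet _ ∧ σ = 1) ∨ (p ∈ SimpleGraph.edgeSet _ ∧ σ = -1)) ↔ _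
    simp only [SimpleGraph.edgeSet_fromEdgeSet]
    constructor
    · rintro (⟨⟨h, -⟩, rfl⟩ | ⟨⟨h, -⟩, rfl⟩) <;> exact h
    · intro h
      have hp := not_isDiag_of_mem_cells (hS h)
      rcases Int.units_eq_one_or σ with rfl | rfl
      · exact Or.inl ⟨⟨h, hp⟩, rfl⟩
      · exact Or.inr ⟨⟨h, hp⟩, rfl⟩
  · rfl
  · rfl

end FullGraph

section CellVec

variable {V : Type*} [LinearOrder V] {p : Sym2 V} {v : V}

theorem cellVec_inl_of_notMem (σ : ℤˣ) (hv : v ∉ p) : cellVec (.inl (p, σ)) v = 0 := by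
  rw [sym2_mem_iff, not_or] at hv
  simp [cellVec, hv.1, hv.2]

theorem isUnit_cellVec_inl_of_mem (hp : ¬ p.IsDiag) (σ : ℤˣ) (hv : v ∈ p) :
    IsUnit (cellVec (.inl (p, σ)) v) := by
  have hlt := sym2_inf_lt_sup hp
  rcases sym2_mem_iff.mp hv with rfl | rfl
  · simp [cellVec, hlt.ne]
  · simp [cellVec, hlt.ne']

theorem cellVec_inl_ne_zero_iff (hp : ¬ p.IsDiag) (σ : ℤˣ) :
    cellVec (.inl (p, σ)) v ≠ 0 ↔ v ∈ p :=
  ⟨fun h => by_contra fun hv => h (cellVec_inl_of_notMem σ hv),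
    fun hv => (isUnit_cellVec_inl_of_mem hp σ hv).ne_zero⟩

theorem cellVec_inl_inj {q : Sym2 V} {σ τ : ℤˣ} (hp : ¬ p.IsDiag) (hq : ¬ q.IsDiag)
    (h : cellVec (.inl (p, σ)) = cellVec (.inl (q, τ))) : p = q ∧ σ = τ := by
  obtain rfl : p = q := Sym2.ext fun v => by
    rw [← cellVec_inl_ne_zero_iff hp σ, h, cellVec_inl_ne_zero_iff hq]
  refine ⟨rfl, ?_⟩
  have hsup := congrFun h p.sup
  simpa [cellVec, (sym2_inf_lt_sup hp).ne', Units.ext_iff] using hsup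

theorem cellVec_inl_ne_single (hp : ¬ p.IsDiag) (σ : ℤˣ) (v : V) (k : ℤ) :
    cellVec (.inl (p, σ)) ≠ Pi.single v k := by
  intro h
  have heq (w : V) (hw : w ∈ p) : w = v := by
    by_contra hne
    refine (cellVec_inl_ne_zero_iff hp σ).mpr hw ?_
    rw [h, Pi.single_eq_of_ne hne]
  refine (sym2_inf_lt_sup hp).ne ((heq _ ?_).trans (heq _ ?_).symm) <;> simp [sym2_mem_iff]

theorem injOn_cellVec (G : SignedGraph V) : Set.InjOn (cellVec : Cell V → V → ℤ) G.cells := by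
  rintro (⟨p, σ⟩ | v | v) he (⟨q, τ⟩ | w | w) hf h
  · obtain ⟨rfl, rfl⟩ :=
      cellVec_inl_inj (not_isDiag_of_mem_cells he) (not_isDiag_of_mem_cells hf) h
    rfl
  · exact absurd h (cellVec_inl_ne_single (not_isDiag_of_mem_cells he) σ w 1)
  · exact absurd h (cellVec_inl_ne_single (not_isDiag_of_mem_cells he) σ w 2)
  · exact absurd h.symm (cellVec_inl_ne_single (not_isDiag_of_mem_cells hf) τ v 1)
  · rw [(single_inj_of_ne_zero one_ne_zero h).1]
  · exact absurd (single_inj_of_ne_zero one_ne_zero h).2 (by norm_num)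
  · exact absurd h.symm (cellVec_inl_ne_single (not_isDiag_of_mem_cells hf) τ v 2)
  · exact absurd (single_inj_of_ne_zero two_ne_zero h).2 (by norm_num)
  · rw [(single_inj_of_ne_zero two_ne_zero h).1]

end CellVec

theorem latticeCast_injective (V : Type*) : Function.Injective (latticeCast V) :=
  Int.cast_injective.comp_left

section Roots

variable {n : ℕ} {Φ : ClassicalType} {y : Fin n → ℝ}

/-- The signed edges, halfedges and loops that encode the positive roots of type `Φ`. -/
noncomputable def rootCells (Φ : ClassicalType) (n : ℕ) : Finset (Cell (Fin n)) :=
  (Set.toFinite (fullGraph (Fin n) Φ).cells).toFinset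

theorem coe_rootCells (Φ : ClassicalType) (n : ℕ) :
    (rootCells Φ n : Set (Cell (Fin n))) = (fullGraph (Fin n) Φ).cells :=
  Set.Finite.coe_toFinset _

theorem mem_rootCells {e : Cell (Fin n)} : e ∈ rootCells Φ n ↔ e ∈ (fullGraph (Fin n) Φ).cells :=
  Set.Finite.mem_toFinset _

theorem latticeCast_single (v : Fin n) (k : ℤ) :
    latticeCast (Fin n) (Pi.single v k) = (k : ℝ) • stdVec v := by
  ext w
  simp [stdVec, Pi.single_apply, apply_ite (Int.cast : ℤ → ℝ)]

theorem latticeCast_cellVec_mk {i j : Fin n} (hij : i < j) (σ : ℤˣ) :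
    latticeCast (Fin n) (cellVec (.inl (s(i, j), σ))) = stdVec i - ((σ : ℤ) : ℝ) • stdVec j := by
  rw [cellVec_mk_of_le hij.le, map_sub, latticeCast_single, latticeCast_single, Int.cast_one,
    one_smul]

theorem mem_rootsMinus : y ∈ rootsMinus n ↔
    ∃ p : Sym2 (Fin n), ¬ p.IsDiag ∧ latticeCast (Fin n) (cellVec (.inl (p, 1))) = y := by
  simp only [exists_not_isDiag_iff, rootsMinus, Finset.mem_image, Finset.mem_filter,
    Finset.mem_univ, true_and, Prod.exists]
  refine exists₂_congr fun i j => and_congr_right fun hij => ?_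
  rw [latticeCast_cellVec_mk hij]
  simp

theorem mem_rootsPlus : y ∈ rootsPlus n ↔
    ∃ p : Sym2 (Fin n), ¬ p.IsDiag ∧ latticeCast (Fin n) (cellVec (.inl (p, -1))) = y := by
  simp only [exists_not_isDiag_iff, rootsPlus, Finset.mem_image, Finset.mem_filter, Finset.mem_univ,
    true_and, Prod.exists]
  refine exists₂_congr fun i j => and_congr_right fun hij => ?_
  rw [latticeCast_cellVec_mk hij]
  simp

theorem mem_rootsShort :
    y ∈ rootsShort n ↔ ∃ v, latticeCast (Fin n) (cellVec (.inr (.inl v))) = y := by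
  simp [rootsShort, cellVec, latticeCast_single]

theorem mem_rootsLong :
    y ∈ rootsLong n ↔ ∃ v, latticeCast (Fin n) (cellVec (.inr (.inr v))) = y := by
  simp [rootsLong, cellVec, latticeCast_single]

theorem posRoots_eq_image (Φ : ClassicalType) (n : ℕ) :
    posRoots n Φ = (rootCells Φ n).image (latticeCast (Fin n) ∘ cellVec) := by
  ext y
  simp only [Finset.mem_image, mem_rootCells, exists_mem_cells_iff]
  cases Φ <;> simp [posRoots, fullGraph, mem_rootsMinus, mem_rootsPlus, mem_rootsShort,
    mem_rootsLong]

theorem sum_posRoots {M : Type*} [AddCommMonoid M] (Φ : ClassicalType) (f : (Fin n → ℝ) → M) :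
    ∑ α ∈ posRoots n Φ, f α = ∑ e ∈ rootCells Φ n, f (latticeCast (Fin n) (cellVec e)) := by
  have hinj : Set.InjOn (latticeCast (Fin n) ∘ cellVec) (rootCells Φ n) := by
    rw [coe_rootCells]
    exact (latticeCast_injective _).comp_injOn (injOn_cellVec _)
  rw [posRoots_eq_image, Finset.sum_image hinj]
  rfl

theorem mem_forests_iff {G : SignedGraph (Fin n)} :
    G ∈ forests Φ n ↔ G.cells ⊆ (fullGraph (Fin n) Φ).cells ∧ G.IsPseudoforest := by
  simp only [forests, Finset.mem_filter, Finset.mem_univ, true_and, isGraphOfType_iff]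

theorem mem_evenForests_iff {G : SignedGraph (Fin n)} :
    G ∈ evenForests Φ n ↔
      G ∈ forests Φ n ∧ ∀ c, (G.component c).Balanced → Even c.supp.ncard := by
  classical
  rw [evenForests, Finset.mem_filter]
  refine and_congr_right fun hG => ?_
  simp only [(mem_forests_iff.mp hG).2.component_isTree_iff]

open Classical in
theorem sum_powerset_rootCells {M : Type*} [AddCommMonoid M] (Φ : ClassicalType) (n : ℕ)
    (f : Set (Cell (Fin n)) → M) :
    (∑ S ∈ (rootCells Φ n).powerset,
      if LinearIndepOn ℝ (latticeCast (Fin n) ∘ cellVec) (S : Set (Cell (Fin n))) then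
        f S else 0) = ∑ G ∈ forests Φ n, f G.cells := by
  rw [← Finset.sum_filter]
  symm
  refine Finset.sum_bij (fun G _ => (Set.toFinite G.cells).toFinset) (fun G hG => ?_)
    (fun G _ H _ h => cells_injective (Set.Finite.toFinset_inj.mp h)) (fun S hS => ?_)
    fun G _ => by rw [Set.Finite.coe_toFinset]
  · rw [mem_forests_iff, ← linearIndepOn_cells_iff] at hG
    rwa [Finset.mem_filter, Finset.mem_powerset, ← Finset.coe_subset, Set.Finite.coe_toFinset,
      coe_rootCells]
  · rw [Finset.mem_filter, Finset.mem_powerset, ← Finset.coe_subset, coe_rootCells] at hS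
    obtain ⟨G, hG⟩ := exists_cells_eq hS.1
    refine ⟨G, ?_, ?_⟩
    · rwa [mem_forests_iff, ← linearIndepOn_cells_iff, hG]
    · rw [← Finset.coe_inj, Set.Finite.coe_toFinset, hG]

end Roots

end SignedGraph

/-! ### Counting lattice points by forests -/

open SignedGraph

section Zonotope

variable {E : Type*} [AddCommGroup E] [Module ℝ E]

theorem smul_segment_eq (t : ℝ) (a b : E) :
    t • segment ℝ a b = segment ℝ (t • a) (t • b) :=
  image_segment ℝ (LinearMap.lsmul ℝ E t).toAffineMap a b

theorem segment_neg_half_smul (a : E) :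
    segment ℝ (-((1 / 2 : ℝ) • a)) ((1 / 2 : ℝ) • a) =
      {-((1 / 2 : ℝ) • a)} + segment ℝ 0 a := by
  rw [Set.singleton_add, segment_translate_image, add_zero]
  congr 1
  module

theorem linearIndepOn_nsmul_iff {ι : Type*} {f : ι → E} {S : Set ι} {t : ℕ} (ht : t ≠ 0) :
    LinearIndepOn ℝ (fun i => t • f i) S ↔ LinearIndepOn ℝ f S := by
  simp only [← Nat.cast_smul_eq_nsmul ℝ t]
  exact LinearIndependent.units_smul_iff (R := ℝ) (v := fun i : S => f i)
    (fun _ => Units.mk0 (t : ℝ) (Nat.cast_ne_zero.mpr ht))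

end Zonotope

section LatticePointCounts

variable {n t : ℕ} (Φ : ClassicalType)

theorem ehr_eq_encard (P : Set (Fin n → ℝ)) (t : ℕ) :
    ehr P t = (latticeCast (Fin n) ⁻¹' ((t : ℝ) • P)).encard := by
  rw [ehr, ← (latticeCast_injective (Fin n)).encard_image]
  congr 1
  ext x
  constructor
  · rintro ⟨hx, hz⟩
    choose z hz using hz
    obtain rfl : latticeCast (Fin n) z = x := funext fun i => (hz i).symm
    exact ⟨z, hx, rfl⟩
  · rintro ⟨z, hz, rfl⟩
    exact ⟨hz, fun i => ⟨z i, rfl⟩⟩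

theorem smul_integralPermutahedron (n t : ℕ) :
    (t : ℝ) • integralPermutahedron Φ n =
      ∑ e ∈ rootCells Φ n, segment ℝ 0 (latticeCast (Fin n) (t • cellVec e)) := by
  rw [integralPermutahedron, sum_posRoots, Finset.smul_sum]
  refine Finset.sum_congr rfl fun e _ => ?_
  rw [smul_segment_eq, smul_zero, map_nsmul, Nat.cast_smul_eq_nsmul]

/-- The sum of the positive roots, as a lattice vector. -/
noncomputable def rootSum (Φ : ClassicalType) (n : ℕ) : Fin n → ℤ :=
  ∑ e ∈ rootCells Φ n, cellVec e

theorem standardPermutahedron_eq (n : ℕ) :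
    standardPermutahedron Φ n =
      {-((1 / 2 : ℝ) • latticeCast (Fin n) (rootSum Φ n))} + integralPermutahedron Φ n := by
  simp only [standardPermutahedron, integralPermutahedron, segment_neg_half_smul]
  rw [Finset.sum_add_distrib, Set.finsetSum_singleton, Finset.sum_neg_distrib,
    ← Finset.smul_sum, sum_posRoots Φ fun α => α, rootSum, map_sum]

theorem smul_standardPermutahedron (n t : ℕ) :
    (t : ℝ) • standardPermutahedron Φ n =
      {-((t / 2 : ℝ) • latticeCast (Fin n) (rootSum Φ n))} +
        ∑ e ∈ rootCells Φ n, segment ℝ 0 (latticeCast (Fin n) (t • cellVec e)) := by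
  rw [standardPermutahedron_eq, smul_add, smul_integralPermutahedron, Set.smul_set_singleton,
    smul_neg, smul_smul, mul_one_div]

open Classical in
theorem encard_translate (ht : t ≠ 0) (w : Fin n → ℝ) :
    (latticeCast (Fin n) ⁻¹' ({w} +
      ∑ e ∈ rootCells Φ n, segment ℝ 0 (latticeCast (Fin n) (t • cellVec e)))).encard =
    ((∑ G ∈ forests Φ n, if ∃ x, latticeCast (Fin n) x - w ∈ G.realSpan then
      2 ^ (G.pc + G.lc) * t ^ (n - G.tc) else 0 : ℕ) : ℕ∞) := by
  have hindep (S : Finset (Cell (Fin n))) :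
      LinearIndepOn ℝ (latticeCast (Fin n) ∘ fun e => t • cellVec e) (S : Set (Cell (Fin n))) ↔
        LinearIndepOn ℝ (latticeCast (Fin n) ∘ cellVec) (S : Set (Cell (Fin n))) := by
    simp only [Function.comp_def, map_nsmul]
    exact linearIndepOn_nsmul_iff ht
  rw [encard_preimage_zonotope (latticeCast (Fin n)) (fun e => t • cellVec e) w (rootCells Φ n)]
  simp only [hindep]
  rw [sum_powerset_rootCells Φ n fun S =>
    residueCount (AddSubgroup.closure ((fun e => t • cellVec e) '' S)) (latticeCast (Fin n) ⁻¹'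
      ({w} + (Submodule.span ℝ ((latticeCast (Fin n) ∘ fun e => t • cellVec e) '' S) :
        Set (Fin n → ℝ)))), Nat.cast_sum]
  refine Finset.sum_congr rfl fun G hG => ?_
  rw [span_nsmul_cells ht, (mem_forests_iff.mp hG).2.residueCount_eq ht w, Nat.card_fin]

theorem encard_translate_latticeCast (ht : t ≠ 0) (x : Fin n → ℤ) :
    (latticeCast (Fin n) ⁻¹' ({latticeCast (Fin n) x} +
      ∑ e ∈ rootCells Φ n, segment ℝ 0 (latticeCast (Fin n) (t • cellVec e)))).encard =
    ((∑ G ∈ forests Φ n, 2 ^ (G.pc + G.lc) * t ^ (n - G.tc) : ℕ) : ℕ∞) := by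
  rw [encard_translate Φ ht]
  congr 1
  refine Finset.sum_congr rfl fun G _ => if_pos ⟨x, ?_⟩
  rw [sub_self]
  exact zero_mem _

theorem ehr_integralPermutahedron (n : ℕ) (ht : t ≠ 0) :
    ehr (integralPermutahedron Φ n) t =
      ((∑ G ∈ forests Φ n, 2 ^ (G.pc + G.lc) * t ^ (n - G.tc) : ℕ) : ℕ∞) := by
  rw [ehr_eq_encard, smul_integralPermutahedron, ← encard_translate_latticeCast Φ ht 0,
    map_zero, Set.singleton_zero, zero_add]

theorem ehr_standardPermutahedron_of_even (ht : t ≠ 0) (h : ∀ v, Even (t * rootSum Φ n v)) :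
    ehr (standardPermutahedron Φ n) t =
      ((∑ G ∈ forests Φ n, 2 ^ (G.pc + G.lc) * t ^ (n - G.tc) : ℕ) : ℕ∞) := by
  choose k hk using h
  have hcenter : -((t / 2 : ℝ) • latticeCast (Fin n) (rootSum Φ n)) = latticeCast (Fin n) (-k) := by
    ext v
    have hv : (t : ℝ) * (rootSum Φ n v : ℝ) = k v + k v := by exact_mod_cast hk v
    simp only [Pi.neg_apply, Pi.smul_apply, latticeCast_apply, smul_eq_mul, Int.cast_neg]
    linarith
  rw [ehr_eq_encard, smul_standardPermutahedron, hcenter, encard_translate_latticeCast Φ ht]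

theorem ehr_standardPermutahedron_of_odd (ht : t ≠ 0) (h : ∀ v, Odd (t * rootSum Φ n v)) :
    ehr (standardPermutahedron Φ n) t =
      ((∑ G ∈ evenForests Φ n, 2 ^ (G.pc + G.lc) * t ^ (n - G.tc) : ℕ) : ℕ∞) := by
  classical
  choose k hk using h
  have hcenter (v : Fin n) : (-((t / 2 : ℝ) • latticeCast (Fin n) (rootSum Φ n))) v =
      (-k v - 1 : ℤ) + 1 / 2 := by
    have hv : (t : ℝ) * (rootSum Φ n v : ℝ) = 2 * k v + 1 := by exact_mod_cast hk v
    simp only [Pi.neg_apply, Pi.smul_apply, latticeCast_apply, smul_eq_mul, Int.cast_neg,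
      Int.cast_sub, Int.cast_one]
    linarith
  have hfilter : evenForests Φ n = (forests Φ n).filter
      fun G => ∀ c, (G.component c).Balanced → Even c.supp.ncard := by
    ext G
    rw [mem_evenForests_iff, Finset.mem_filter]
  rw [ehr_eq_encard, smul_standardPermutahedron, encard_translate Φ ht, hfilter,
    Finset.sum_filter]
  simp only [exists_latticeCast_sub_mem_realSpan_iff hcenter]

end LatticePointCounts

section Parity

open Classical in
theorem sum_cells {V M : Type*} [Fintype V] [AddCommMonoid M] (G : SignedGraph V)
    (f : Cell V → M) :
    ∑ e with e ∈ G.cells, f e =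
      ∑ p with p ∈ G.pos.edgeSet, f (.inl (p, 1)) + ∑ p with p ∈ G.neg.edgeSet, f (.inl (p, -1)) +
        (∑ v with v ∈ G.half, f (.inr (.inl v)) + ∑ v with v ∈ G.loop, f (.inr (.inr v))) := by
  have hsigns : (Finset.univ : Finset ℤˣ) = {1, -1} := by decide
  have hne : (1 : ℤˣ) ≠ -1 := by decide
  simp only [Finset.sum_filter, Fintype.sum_sum_type, Fintype.sum_prod_type]
  rw [← Finset.sum_add_distrib (ι := Sym2 V)]
  refine congrArg₂ (· + ·) (Finset.sum_congr rfl fun p _ => ?_) rfl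
  rw [hsigns, Finset.sum_pair hne]
  simp [cells, edges, hne, hne.symm]

theorem intCast_zmod_two_of_isUnit {a : ℤ} (ha : IsUnit a) : (a : ZMod 2) = 1 := by
  rcases Int.isUnit_iff.mp ha with rfl | rfl <;> decide

open Classical in
theorem cellVec_inl_zmod_two {V : Type*} [LinearOrder V] {p : Sym2 V} (hp : ¬ p.IsDiag) (σ : ℤˣ)
    (v : V) : (cellVec (.inl (p, σ)) v : ZMod 2) = if v ∈ p then 1 else 0 := by
  split_ifs with hv
  · exact intCast_zmod_two_of_isUnit (isUnit_cellVec_inl_of_mem hp σ hv)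
  · rw [cellVec_inl_of_notMem σ hv, Int.cast_zero]

open Classical in
theorem sum_edgeSet_cellVec_zmod_two {V : Type*} [Fintype V] [LinearOrder V] (H : SimpleGraph V)
    (σ : ℤˣ) (v : V) :
    ∑ p with p ∈ H.edgeSet, (cellVec (.inl (p, σ)) v : ZMod 2) = (H.neighborSet v).ncard := by
  rw [Finset.sum_congr rfl fun p hp => cellVec_inl_zmod_two
    (H.not_isDiag_of_mem_edgeSet (Finset.mem_filter.mp hp).2) σ v, Finset.sum_boole,
    Set.ncard_eq_toFinset_card', ← SimpleGraph.neighborFinset_def,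
    SimpleGraph.card_neighborFinset_eq_degree, ← SimpleGraph.card_incidenceFinset_eq_degree,
    SimpleGraph.incidenceFinset_eq_filter]
  congr 2
  ext p
  simp

open Classical in
theorem sum_cells_cellVec_zmod_two {V : Type*} [Fintype V] [LinearOrder V] (G : SignedGraph V)
    (v : V) :
    ∑ e with e ∈ G.cells, (cellVec e v : ZMod 2) =
      (G.pos.neighborSet v).ncard + (G.neg.neighborSet v).ncard + if v ∈ G.half then 1 else 0 := by
  have htwo : (2 : ZMod 2) = 0 := rfl
  rw [sum_cells, sum_edgeSet_cellVec_zmod_two, sum_edgeSet_cellVec_zmod_two]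
  simp [cellVec, Pi.single_apply, apply_ite (Int.cast : ℤ → ZMod 2), htwo]

theorem rootSum_zmod_two (Φ : ClassicalType) (n : ℕ) (v : Fin n) :
    (rootSum Φ n v : ZMod 2) = match Φ with
      | .A => ((n - 1 : ℕ) : ZMod 2)
      | .B => 1
      | _ => 0 := by
  classical
  have hroots : rootCells Φ n = Finset.univ.filter (· ∈ (fullGraph (Fin n) Φ).cells) := by
    ext e
    simp [mem_rootCells]
  rw [rootSum, Finset.sum_apply, Int.cast_sum, hroots, sum_cells_cellVec_zmod_two]
  have htop : ((⊤ : SimpleGraph (Fin n)).neighborSet v).ncard = n - 1 := by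
    rw [SimpleGraph.neighborSet_top, Set.ncard_compl, Set.ncard_singleton, Nat.card_fin]
  cases Φ <;> simp [fullGraph, htop, CharTwo.add_self_eq_zero, -SimpleGraph.neighborSet_top]

theorem even_mul_rootSum {Φ : ClassicalType} {n t : ℕ}
    (h : Even t ∨ (Φ = .A ∧ Odd n) ∨ Φ = .C ∨ Φ = .D) (v : Fin n) : Even (t * rootSum Φ n v) := by
  rw [← ZMod.intCast_eq_zero_iff_even, Int.cast_mul, Int.cast_natCast, rootSum_zmod_two]
  rcases h with h | ⟨rfl, h⟩ | rfl | rfl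
  · rw [ZMod.natCast_eq_zero_iff_even.mpr h, zero_mul]
  · rw [ZMod.natCast_eq_zero_iff_even.mpr (Nat.Odd.sub_odd h odd_one), mul_zero]
  · exact mul_zero _
  · exact mul_zero _

theorem odd_mul_rootSum {Φ : ClassicalType} {n t : ℕ} (ht : Odd t)
    (h : (Φ = .A ∧ Even n) ∨ Φ = .B) (v : Fin n) : Odd (t * rootSum Φ n v) := by
  rw [← ZMod.intCast_eq_one_iff_odd, Int.cast_mul, Int.cast_natCast, rootSum_zmod_two,
    ZMod.natCast_eq_one_iff_odd.mpr ht, one_mul]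
  rcases h with ⟨rfl, h⟩ | rfl
  · exact ZMod.natCast_eq_one_iff_odd.mpr (Nat.Even.sub_odd v.pos h odd_one)
  · rfl

end Parity

section Forests

variable {Φ : ClassicalType} {n : ℕ} {G : SignedGraph (Fin n)}

theorem lc_eq_zero_of_mem_forests (hΦ : Φ = .A ∨ Φ = .B) (hG : G ∈ forests Φ n) : G.lc = 0 := by
  obtain ⟨-, -, -, hloop⟩ := cells_subset_iff.mp (mem_forests_iff.mp hG).1
  refine lc_eq_zero (Set.subset_eq_empty hloop ?_)
  rcases hΦ with rfl | rfl <;> rfl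

theorem sum_two_pow_pc_add_lc {S : Finset (SignedGraph (Fin n))} (hΦ : Φ = .A ∨ Φ = .B)
    (hS : S ⊆ forests Φ n) (t : ℕ) :
    ∑ G ∈ S, 2 ^ (G.pc + G.lc) * t ^ (n - G.tc) = ∑ G ∈ S, 2 ^ G.pc * t ^ (n - G.tc) :=
  Finset.sum_congr rfl fun G hG => by rw [lc_eq_zero_of_mem_forests hΦ (hS hG), add_zero]

theorem evenForests_subset (Φ : ClassicalType) (n : ℕ) : evenForests Φ n ⊆ forests Φ n :=
  fun _ hG => (mem_evenForests_iff.mp hG).1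

theorem ncard_cells_of_mem_forests (hG : G ∈ forests Φ n) : G.cells.ncard = n - G.tc := by
  rw [(mem_forests_iff.mp hG).2.ncard_cells, Nat.card_fin]

theorem cells_nonempty_of_mem_evenForests (hn : 1 ≤ n) (hG : G ∈ evenForests Φ n) :
    G.cells.Nonempty := by
  rw [Set.nonempty_iff_ne_empty]
  intro hempty
  obtain ⟨x, hx⟩ := (exists_latticeCast_sub_mem_realSpan_iff (G := G) (k := 0)
    (w := fun _ => 1 / 2) fun _ => by simp).mpr (mem_evenForests_iff.mp hG).2
  rw [realSpan, hempty, Set.image_empty, Submodule.span_empty, Submodule.mem_bot] at hx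
  have hhalf : (x ⟨0, hn⟩ : ℝ) = 1 / 2 := sub_eq_zero.mp (congrFun hx ⟨0, hn⟩)
  have hodd : 2 * x ⟨0, hn⟩ = 1 := by
    have hcast : (2 * x ⟨0, hn⟩ : ℝ) = 1 := by linarith
    exact_mod_cast hcast
  omega

theorem exists_mem_forests_cells_eq_empty (Φ : ClassicalType) (n : ℕ) :
    ∃ G ∈ forests Φ n, G.cells = ∅ := by
  obtain ⟨G, hG⟩ := exists_cells_eq (Set.empty_subset (fullGraph (Fin n) Φ).cells)
  refine ⟨G, mem_forests_iff.mpr ⟨hG ▸ Set.empty_subset _, linearIndepOn_cells_iff.mp ?_⟩, hG⟩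
  rw [hG]
  exact linearIndepOn_empty _ _

open Polynomial in
theorem natCast_sum_two_pow_mul_pow {ι : Type*} (S : Finset ι) (a b : ι → ℕ) (t : ℕ) :
    ((∑ i ∈ S, 2 ^ a i * t ^ b i : ℕ) : ℚ) =
      (∑ i ∈ S, C ((2 : ℚ) ^ a i) * X ^ b i).eval (t : ℚ) := by
  simp [eval_finsetSum]

-- Only the left-hand side has a nonzero constant coefficient.
open Polynomial in
theorem sum_forests_ne_sum_evenForests (Φ : ClassicalType) (hn : 1 ≤ n) :
    (∑ G ∈ forests Φ n, C ((2 : ℚ) ^ G.pc) * X ^ (n - G.tc) : Polynomial ℚ) ≠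
      ∑ G ∈ evenForests Φ n, C ((2 : ℚ) ^ G.pc) * X ^ (n - G.tc) := by
  intro h
  have heval := congrArg (eval ((0 : ℕ) : ℚ)) h
  rw [← natCast_sum_two_pow_mul_pow, ← natCast_sum_two_pow_mul_pow, Nat.cast_inj] at heval
  have hzero : ∑ G ∈ evenForests Φ n, 2 ^ G.pc * 0 ^ (n - G.tc) = 0 := by
    refine Finset.sum_eq_zero fun G hG => ?_
    rw [← ncard_cells_of_mem_forests (evenForests_subset Φ n hG), zero_pow, mul_zero]
    exact ((Set.ncard_pos (Set.toFinite _)).mpr (cells_nonempty_of_mem_evenForests hn hG)).ne'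
  obtain ⟨G, hG, hempty⟩ := exists_mem_forests_cells_eq_empty Φ n
  have hterm := Finset.sum_eq_zero_iff.mp (heval.trans hzero) G hG
  rw [← ncard_cells_of_mem_forests hG, hempty, Set.ncard_empty, pow_zero, mul_one] at hterm
  exact pow_ne_zero _ two_ne_zero hterm

end Forests

theorem isLeast_period_ite_even {α : Type*} {a b : α} (hab : a ≠ b) :
    IsLeast {r : ℕ | 0 < r ∧
      Function.Periodic (fun t : ℤ => if Even t then a else b) (r : ℤ)} 2 := by
  refine ⟨⟨two_pos, fun t => by simp⟩, fun r ⟨hr, hper⟩ => ?_⟩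
  by_contra hlt
  obtain rfl : r = 1 := by omega
  have hone := hper 0
  simp only [Nat.cast_one, zero_add, Int.not_even_one, if_false, Even.zero, if_true] at hone
  exact hab hone.symm

open Polynomial in
theorem isEhrhartQuasipolynomial_ite_even {n : ℕ} {P : Set (Fin n → ℝ)} {f g : Polynomial ℚ}
    (hfg : f ≠ g)
    (heven : ∀ t : ℕ, 0 < t → Even t → ∃ m : ℕ, ehr P t = m ∧ (m : ℚ) = f.eval (t : ℚ))
    (hodd : ∀ t : ℕ, 0 < t → Odd t → ∃ m : ℕ, ehr P t = m ∧ (m : ℚ) = g.eval (t : ℚ)) :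
    IsEhrhartQuasipolynomial P 2 fun t => if Even t then f else g where
  period := isLeast_period_ite_even hfg
  count t ht := by
    simp only [Int.even_coe_nat]
    split_ifs with h
    · exact heven t ht h
    · exact hodd t ht (Nat.not_even_iff_odd.mp h)

open Polynomial in
theorem theorem4p3 (n : ℕ) (hn : 1 ≤ n) :
    -- the integral Coxeter permutahedra
    (∀ Φ : ClassicalType,
      IsEhrhartPolynomial (integralPermutahedron Φ n)
        (∑ G ∈ forests Φ n, C ((2 : ℚ) ^ (G.pc + G.lc)) * X ^ (n - G.tc))) ∧
    -- the standard Coxeter permutahedra of `A_{n-1}`, `n` even, and of `B_n`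
    (∀ Φ : ClassicalType, (Φ = .A ∧ Even n) ∨ Φ = .B →
      IsEhrhartQuasipolynomial (standardPermutahedron Φ n) 2
        (fun t : ℤ =>
          if Even t then ∑ G ∈ forests Φ n, C ((2 : ℚ) ^ G.pc) * X ^ (n - G.tc)
          else ∑ G ∈ evenForests Φ n, C ((2 : ℚ) ^ G.pc) * X ^ (n - G.tc))) ∧
    -- the standard Coxeter permutahedra of `A_{n-1}`, `n` odd, of `C_n` and of `D_n`
    (∀ Φ : ClassicalType, (Φ = .A ∧ Odd n) ∨ Φ = .C ∨ Φ = .D →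
      ∀ t : ℕ, 0 < t →
        ehr (standardPermutahedron Φ n) t = ehr (integralPermutahedron Φ n) t) := by
  refine ⟨fun Φ t ht => ⟨_, ehr_integralPermutahedron Φ n ht.ne',
    natCast_sum_two_pow_mul_pow _ _ _ _⟩, fun Φ hΦ => ?_, fun Φ hΦ t ht => ?_⟩
  · have hAB : Φ = .A ∨ Φ = .B := hΦ.imp_left And.left
    refine isEhrhartQuasipolynomial_ite_even (sum_forests_ne_sum_evenForests Φ hn)
      (fun t ht h => ⟨_, ?_, natCast_sum_two_pow_mul_pow _ _ _ _⟩)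
      (fun t ht h => ⟨_, ?_, natCast_sum_two_pow_mul_pow _ _ _ _⟩)
    · rw [← sum_two_pow_pc_add_lc hAB subset_rfl]
      exact ehr_standardPermutahedron_of_even Φ ht.ne' (even_mul_rootSum (Or.inl h))
    · rw [← sum_two_pow_pc_add_lc hAB (evenForests_subset Φ n)]
      exact ehr_standardPermutahedron_of_odd Φ ht.ne' (odd_mul_rootSum h hΦ)
  · rw [ehr_integralPermutahedron Φ n ht.ne',
      ehr_standardPermutahedron_of_even Φ ht.ne' (even_mul_rootSum (Or.inr hΦ))]
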